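/- Let $X_0,X_1,\dots$ be i.i.d. with probability mass function $P$ on a finite alphabet $\mathcal X$ with $|\mathcal X|\ge 2$ and $P(x)>0$ for all $x$. The Huffman length is $L(X)=\min_l\sum_{x}P(x)l(x)$, the minimum over all $l:\mathcal X\to\{1,2,\dots\}$ with $\sum_x 2^{-l(x)}\le 1$. Alice and Bob share a key sequence $u$ of i.i.d. fair bits. Alice also has private i.i.d. randomness $V_0,V_1,\dots$ (with a law that is part of the encoder). Source, key and private randomness are independent. *Encoder.* In stage $t$ Alice reads unused key bits one at a time. A stopping rule that may depend on $K_0,\dots,K_{t-1},V_t,X_0,\dots,X_t$ and on the bits read in this stage, and that stops almost surely, determines the key segment $K_t$ of the stage, of length $l_{K_t}$. She then sends a finite binary string $Z_t=f_t(K_0,\dots,K_t,V_t,X_0,\dots,X_t)$. Let $B_n$ be the concatenation of $Z_0,\dots,Z_{n-1}$ (the unparsed bit stream after $n$ stages) and $l_{B_n}$ its length. The encoder rate is $\limsup_n\frac1n\mathbb E\,l_{B_n}$ and the key rate is $\limsup_n\frac1n\sum_{t<n}\mathbb E\,l_{K_t}$ (values in $[0,\infty]$). *Decoder.* Bob holds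 the key sequence and the unparsed bit stream. For each history $(K_i,Z_i)_{i<t}$ he has a set of admissible pairs $(k,z)$ of finite binary strings such that no two distinct pairs $(k,z),(k',z')$ in it have both $k,k'$ comparable and $z,z'$ comparable in the prefix order (the code is instantaneous). He parses stage $t$ as the admissible pair whose first entry is a prefix of the unused key bits and whose second entry is a prefix of the unread bit stream, and he then outputs $g_t(K_0,\dots,K_t,Z_0,\dots,Z_t)$. The pair is lossless if almost surely, for every $t$, $(K_t,Z_t)$ is admissible and the output is $X_t$. Consider lossless encoder–decoder pairs for which the past keys asymptotically give no information on $X_t$ beyond that in the bit stream: for all $t$ and $x$, almost surely $$P(X_t=x\mid B_n,K_0,\dots,K_{t-1})-P(X_t=x\mid B_n)\to 0\qquad(n\to\infty).$$ Let $R,R_K\in[0,\infty]$. There is such a pair that has encoder rate at most $R$ and key rate at most $R_K$, and that satisfies the secrecy constraint $$P(X_t=x\mid B_n)\to P(x)\quad\text{almost surely as }n\to\infty,\text{ for all }t\text{ and }x,$$ if and only if $R\ge L(X)$ and $R_K\ge L(X)$. -/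

import Mathlib

open MeasureTheory ProbabilityTheory Filter Topology
open scoped ENNReal

namespace RealTimeSecrecy

/-- Finite binary strings. -/
abbrev Bits := List Bool

/-- The Huffman length `L(X)` of a source with probability mass function `P`: the least expected
length over all length functions with positive integer values that satisfy Kraft's inequality. -/
noncomputable def huffmanLength {𝒳 : Type*} [Fintype 𝒳] (P : PMF 𝒳) : ℝ :=
  sInf {r : ℝ | ∃ l : 𝒳 → ℕ, (∀ x, 0 < l x) ∧ ∑ x, ((1 : ℝ) / 2) ^ l x ≤ 1 ∧
    r = ∑ x, (P x).toReal * (l x : ℝ)}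

/-- The law of one key bit: a fair coin. -/
noncomputable def coin : Measure Bool := (PMF.uniformOfFintype Bool).toMeasure

/-- The law of the key sequence: i.i.d. fair bits. -/
noncomputable def keyLaw : Measure (ℕ → Bool) := Measure.infinitePi fun _ => coin

/-- The first `j` bits of a bit sequence. -/
def firstBits (u : ℕ → Bool) (j : ℕ) : Bits := (List.range j).map u

/-- Outcomes: the source sequence, the key sequence and the private randomness of Alice.
Stages are numbered from `0`. -/
abbrev Outcome (𝒳 V : Type*) := (ℕ → 𝒳) × (ℕ → Bool) × (ℕ → V)

/-- The joint law: the source is i.i.d. with law `P`, the key is i.i.d. fair bits, the private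
randomness is i.i.d. with law `ν`, and the three sequences are independent. -/
noncomputable def law {𝒳 V : Type*} [MeasurableSpace 𝒳] [MeasurableSpace V]
    (P : PMF 𝒳) (ν : Measure V) : Measure (Outcome 𝒳 V) :=
  (Measure.infinitePi fun _ => P.toMeasure).prod (keyLaw.prod (Measure.infinitePi fun _ => ν))

/-- A real-time encoder. In the stage whose source symbol is the last entry of the list `xs`
(the symbols observed up to now), with `ks` the list of key segments used in the earlier stages and
`v` the private randomness of the stage, Alice reads unused key bits one at a time until the bits
`k` read in this stage satisfy `halts ks v xs k`. They form the key segment of the stage.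
She then sends the string `code ks' v xs`, where `ks'` is `ks` followed by the new segment. -/
structure Encoder (𝒳 V : Type*) [MeasurableSpace V] where
  halts : List Bits → V → List 𝒳 → Bits → Prop
  code : List Bits → V → List 𝒳 → Bits
  halts_ae : ∀ ks v xs, ∀ᵐ u ∂keyLaw, ∃ j, halts ks v xs (firstBits u j)
  measurableSet_halts : ∀ ks xs k, MeasurableSet {v | halts ks v xs k}
  measurableSet_code : ∀ ks xs z, MeasurableSet {v | code ks v xs = z}

/-- A real-time decoder. Bob holds the key sequence and the unparsed bit stream. If `ks` and `zs` are
the lists of key segments and codewords of the earlier stages, he parses the next stage as the pair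
`(k, z) ∈ accept ks zs` for which `k` is a prefix of the unused key bits and `z` is a prefix of the
unread bit stream. By `instantaneous` there is at most one such pair, whatever follows in the two
sequences. Then he outputs `out ks' zs'`, where `ks'` and `zs'` include the new stage. -/
structure Decoder (𝒳 : Type*) where
  accept : List Bits → List Bits → Set (Bits × Bits)
  instantaneous : ∀ ks zs, ∀ p ∈ accept ks zs, ∀ q ∈ accept ks zs,
    (p.1 <+: q.1 ∨ q.1 <+: p.1) → (p.2 <+: q.2 ∨ q.2 <+: p.2) → p = q
  out : List Bits → List Bits → 𝒳

section Run

variable {𝒳 V : Type*} [MeasurableSpace V] (E : Encoder 𝒳 V)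

/-- The source symbol `X_t`. -/
def sym (t : ℕ) (ω : Outcome 𝒳 V) : 𝒳 := ω.1 t

/-- The source symbols of the first `n` stages. -/
def syms (n : ℕ) (ω : Outcome 𝒳 V) : List 𝒳 := (List.range n).map ω.1

open Classical in
/-- The key segment of a stage, cut from the unused key sequence `u`. -/
noncomputable def Encoder.segment (ks : List Bits) (v : V) (xs : List 𝒳) (u : ℕ → Bool) : Bits :=
  if h : ∃ j, E.halts ks v xs (firstBits u j) then firstBits u (Nat.find h) else []

/-- The key segments of the first `n` stages. -/
noncomputable def Encoder.keys : ℕ → Outcome 𝒳 V → List Bits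
  | 0, _ => []
  | n + 1, ω => Encoder.keys n ω ++
      [E.segment (Encoder.keys n ω) (ω.2.2 n) (syms (n + 1) ω)
        fun i => ω.2.1 ((Encoder.keys n ω).flatten.length + i)]

/-- The key segment `K_t` of stage `t`. -/
noncomputable def Encoder.key (t : ℕ) (ω : Outcome 𝒳 V) : Bits :=
  E.segment (E.keys t ω) (ω.2.2 t) (syms (t + 1) ω)
    fun i => ω.2.1 ((E.keys t ω).flatten.length + i)

/-- The codeword `Z_t` of stage `t`: a function of the key segments up to and including stage `t`,
the private randomness of stage `t` and the source symbols up to and including stage `t`. -/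
noncomputable def Encoder.word (t : ℕ) (ω : Outcome 𝒳 V) : Bits :=
  E.code (E.keys (t + 1) ω) (ω.2.2 t) (syms (t + 1) ω)

/-- The codewords of the first `n` stages. -/
noncomputable def Encoder.words (n : ℕ) (ω : Outcome 𝒳 V) : List Bits :=
  (List.range n).map fun t => E.word t ω

/-- The unparsed bit string `B_n` sent in the first `n` stages. -/
noncomputable def Encoder.stream (n : ℕ) (ω : Outcome 𝒳 V) : Bits := (E.words n ω).flatten

variable [MeasurableSpace 𝒳] (μ : Measure (Outcome 𝒳 V))

/-- The encoder rate `limsup (1/n) E[length of B_n]`. -/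
noncomputable def Encoder.rate : ℝ≥0∞ :=
  limsup (fun n : ℕ => (∫⁻ ω, ((E.stream n ω).length : ℝ≥0∞) ∂μ) / (n : ℝ≥0∞)) atTop

/-- The key rate `limsup (1/n) ∑_{t < n} E[length of K_t]`. -/
noncomputable def Encoder.keyRate : ℝ≥0∞ :=
  limsup (fun n : ℕ =>
    (∑ t ∈ Finset.range n, ∫⁻ ω, ((E.key t ω).length : ℝ≥0∞) ∂μ) / (n : ℝ≥0∞)) atTop

/-- Almost surely Bob parses every stage correctly and reproduces its source symbol without
delay. -/
def Lossless (D : Decoder 𝒳) : Prop :=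
  ∀ᵐ ω ∂μ, ∀ t, (E.key t ω, E.word t ω) ∈ D.accept (E.keys t ω) (E.words t ω) ∧
    D.out (E.keys (t + 1) ω) (E.words (t + 1) ω) = sym t ω

/-- The conditional probability `P(X_t = x | B_n)` as a random variable. -/
noncomputable def Encoder.posterior (t : ℕ) (x : 𝒳) (n : ℕ) (ω : Outcome 𝒳 V) : ℝ :=
  (μ[|{ω' | E.stream n ω' = E.stream n ω}]).real {ω' | sym t ω' = x}

/-- The conditional probability of `X_t = x` given `B_n` and the key segments of all the stages
before stage `t`, as a random variable. -/
noncomputable def Encoder.posteriorKey (t : ℕ) (x : 𝒳) (n : ℕ) (ω : Outcome 𝒳 V) : ℝ :=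
  (μ[|{ω' | E.stream n ω' = E.stream n ω ∧ E.keys t ω' = E.keys t ω}]).real {ω' | sym t ω' = x}

/-- The secrecy constraint: `P(X_t = x | B_n) → P(x)` almost surely as `n → ∞`. -/
def Secret (P : PMF 𝒳) : Prop :=
  ∀ (t : ℕ) (x : 𝒳), ∀ᵐ ω ∂μ,
    Tendsto (fun n => E.posterior μ t x n ω) atTop (𝓝 (P x).toReal)

/-- The Markov chain `X_t ↔ B_n ↔ (K_0, …, K_{t-1})`, in the limit of a long bit stream: the past
keys do not change the conditional law of `X_t` given `B_n`, up to an error that almost surely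
vanishes as `n → ∞`. -/
def MarkovKeys : Prop :=
  ∀ (t : ℕ) (x : 𝒳), ∀ᵐ ω ∂μ,
    Tendsto (fun n => E.posteriorKey μ t x n ω - E.posterior μ t x n ω) atTop (𝓝 0)

end Run

end RealTimeSecrecy

open RealTimeSecrecy

/-! Both lower bounds hold stage by stage: in each case a prefix-free code for the alphabet is found
inside stage `t`, and Kraft's inequality applies to it.

Codewords: freeze everything except `X_t`. The history of stage `t` is then fixed and all possible
key segments are prefixes of one sequence, so the instantaneous condition forces the codewords of
distinct symbols to be incomparable (`Encoder.word_resample_prefixFree`). Redrawing `X_t` preserves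
the joint law (`measurePreserving_resample`), so averaging gives the bound. Secrecy plays no role
here.

Keys: fix instead `B_n` with `n > t` and the keys before stage `t`. These determine the past
codewords, and the possible codewords of stage `t` are comparable as pieces of one stream. Now the
key segments of distinct symbols must be incomparable, so the shortest segments, one for each
symbol, form a prefix-free code. The conditional expected key length is at least the mean length of
this code under the posterior of `X_t`. The Markov and secrecy conditions make that posterior tend
to `P`, and Fatou's lemma concludes (`huffmanLength_le_lintegral_key`).

Achievability: apply a one-time pad to an optimal prefix-free code. The length of the stream still
leaks information, so secrecy is only asymptotic. Exchanging two symbols and correcting the key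
preserves both the stream and the law, so given the stream all symbols have the same conditional law
(`cond_view_sym_eq`). The posterior of `X_t` is thus the conditional mean of an empirical frequency,
which concentrates exponentially fast at `P`. The symmetry among the stages from `s` on survives
revealing the keys before stage `s`: `s = 0` gives secrecy, and `s = t` together with `s = 0` gives
the Markov condition. -/

namespace RealTimeSecrecy

/-! ### Kraft's inequality and the Huffman length -/

section Kraft

/-- The first codewords of two parsings of one string are both prefixes of it, hence comparable,
hence equal; cancel and repeat. This makes the Kraft–McMillan inequality available. -/
lemma uniquelyDecodable_of_prefixFree {S : Set Bits} (hne : [] ∉ S)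
    (hS : ∀ v ∈ S, ∀ w ∈ S, v <+: w → v = w) : InformationTheory.UniquelyDecodable S := by
  intro L₁
  induction L₁ with
  | nil =>
    intro L₂ _ h₂ h
    cases L₂ with
    | nil => rfl
    | cons w L₂ =>
      have : w = [] := by simp_all
      exact absurd (this ▸ h₂ w (by simp)) hne
  | cons v L₁ ih =>
    intro L₂ h₁ h₂ h
    cases L₂ with
    | nil =>
      have : v = [] := by simp_all
      exact absurd (this ▸ h₁ v (by simp)) hne
    | cons w L₂ =>
      have hv := h₁ v (by simp)
      have hw := h₂ w (by simp)
      simp only [List.flatten_cons] at h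
      have hvw : v = w := by
        rcases List.prefix_or_prefix_of_prefix (List.prefix_append v L₁.flatten)
          (h ▸ List.prefix_append w L₂.flatten) with h' | h'
        · exact hS v hv w hw h'
        · exact (hS w hw v hv h').symm
      subst hvw
      rw [ih L₂ (fun u hu => h₁ u (by simp [hu])) (fun u hu => h₂ u (by simp [hu]))
        (List.append_cancel_left h)]

/-- The codewords of a prefix-free code with at least two codewords are nonempty. -/
lemma length_pos_of_prefixFree {𝒳 : Type*} [Nontrivial 𝒳] {c : 𝒳 → Bits}
    (hc : ∀ x y, c x <+: c y → x = y) (x : 𝒳) : 0 < (c x).length := by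
  obtain ⟨y, hy⟩ := exists_ne x
  rw [List.length_pos_iff]
  intro h
  exact hy (hc x y (by simp [h])).symm

variable {𝒳 : Type*} [Fintype 𝒳]

/-- Kraft's inequality for prefix-free codes. -/
lemma kraft_of_prefixFree [Nontrivial 𝒳] {c : 𝒳 → Bits}
    (hc : ∀ x y, c x <+: c y → x = y) : ∑ x, ((1 : ℝ) / 2) ^ (c x).length ≤ 1 := by
  classical
  have hinj : Function.Injective c := fun x y h => hc x y (h ▸ List.prefix_rfl)
  have hud : InformationTheory.UniquelyDecodable
      ((Finset.univ.image c : Finset Bits) : Set Bits) := by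
    apply uniquelyDecodable_of_prefixFree
    · intro h
      obtain ⟨x, -, hx⟩ := Finset.mem_image.1 (Finset.mem_coe.1 h)
      have := length_pos_of_prefixFree hc x
      simp [hx] at this
    · intro v hv w hw h
      obtain ⟨x, -, rfl⟩ := Finset.mem_image.1 (Finset.mem_coe.1 hv)
      obtain ⟨y, -, rfl⟩ := Finset.mem_image.1 (Finset.mem_coe.1 hw)
      rw [hc x y h]
  have := InformationTheory.kraft_mcmillan_inequality hud
  rw [Finset.sum_image hinj.injOn] at this
  simpa using this

/-- Counting: `c x` has `2 ^ (m - (c x).length)` extensions of length `m`, and by the strict Kraft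
inequality these do not exhaust all `2 ^ m` strings. -/
lemma exists_length_eq_not_prefix {α : Type*} (s : Finset α) (c : α → Bits) (m : ℕ)
    (hm : ∀ x ∈ s, (c x).length ≤ m) (hs : ∑ x ∈ s, ((1 : ℝ) / 2) ^ (c x).length < 1) :
    ∃ w : Bits, w.length = m ∧ ∀ x ∈ s, ¬ c x <+: w := by
  classical
  let bad : Finset Bits := s.biUnion fun x =>
    (Finset.univ : Finset (Fin (m - (c x).length) → Bool)).image fun v => c x ++ List.ofFn v
  let all : Finset Bits := (Finset.univ : Finset (Fin m → Bool)).image List.ofFn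
  have hall : all.card = 2 ^ m := by
    rw [Finset.card_image_of_injective _ List.ofFn_injective]
    simp
  have hbad : bad.card < 2 ^ m := by
    have h1 : bad.card ≤ ∑ x ∈ s, 2 ^ (m - (c x).length) := by
      refine Finset.card_biUnion_le.trans (Finset.sum_le_sum fun x _ => ?_)
      refine Finset.card_image_le.trans ?_
      simp
    have h2 : ((∑ x ∈ s, 2 ^ (m - (c x).length) : ℕ) : ℝ) < 2 ^ m := by
      have : ((∑ x ∈ s, 2 ^ (m - (c x).length) : ℕ) : ℝ)
          = 2 ^ m * ∑ x ∈ s, ((1 : ℝ) / 2) ^ (c x).length := by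
        push_cast
        rw [Finset.mul_sum]
        refine Finset.sum_congr rfl fun x hx => ?_
        rw [pow_sub₀ _ two_ne_zero (hm x hx), one_div, inv_pow]
      rw [this]
      exact mul_lt_of_lt_one_right (by positivity) hs
    exact_mod_cast (Nat.cast_le (α := ℝ).2 h1).trans_lt h2
  obtain ⟨w, hw, hwb⟩ := Finset.exists_mem_notMem_of_card_lt_card (hall ▸ hbad)
  obtain ⟨v, -, rfl⟩ := Finset.mem_image.1 hw
  refine ⟨List.ofFn v, List.length_ofFn, fun x hx h => hwb ?_⟩
  obtain ⟨r, hr⟩ := h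
  have hl : r.length = m - (c x).length := by
    have := congrArg List.length hr
    simp at this
    omega
  rw [← hr]
  refine Finset.mem_biUnion.2 ⟨x, hx, Finset.mem_image.2 ?_⟩
  refine ⟨fun i => r.get (i.cast hl.symm), Finset.mem_univ _, ?_⟩
  congr 1
  apply List.ext_get
  · simp [hl]
  · simp

/-- Lengths that satisfy Kraft's inequality are the lengths of a prefix-free code. -/
lemma exists_prefixFree {l : 𝒳 → ℕ} (hl : ∑ x, ((1 : ℝ) / 2) ^ l x ≤ 1) :
    ∃ c : 𝒳 → Bits, (∀ x, (c x).length = l x) ∧ ∀ x y, c x <+: c y → x = y := by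
  classical
  suffices ∀ s : Finset 𝒳, ∃ c : 𝒳 → Bits, (∀ x ∈ s, (c x).length = l x) ∧
      ∀ x ∈ s, ∀ y ∈ s, c x <+: c y → x = y by
    obtain ⟨c, h1, h2⟩ := this Finset.univ
    exact ⟨c, fun x => h1 x (by simp), fun x y => h2 x (by simp) y (by simp)⟩
  intro s
  -- Symbols enter in order of increasing length. A new word is then never shorter than an old one,
  -- so it only has to avoid having an old word as a prefix.
  induction s using Finset.induction_on_max_value l with
  | empty => exact ⟨fun _ => [], by simp, by simp⟩
  | insert a s has hmax ih =>
    obtain ⟨c, h1, h2⟩ := ih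
    have hlt : ∑ x ∈ s, ((1 : ℝ) / 2) ^ (c x).length < 1 := by
      have : ∑ x ∈ s, ((1 : ℝ) / 2) ^ (c x).length = ∑ x ∈ s, ((1 : ℝ) / 2) ^ l x :=
        Finset.sum_congr rfl fun x hx => by rw [h1 x hx]
      rw [this]
      have h3 : ∑ x ∈ insert a s, ((1 : ℝ) / 2) ^ l x ≤ ∑ x, ((1 : ℝ) / 2) ^ l x :=
        Finset.sum_le_sum_of_subset_of_nonneg (Finset.subset_univ _) fun _ _ _ => by positivity
      rw [Finset.sum_insert has] at h3
      have : 0 < ((1 : ℝ) / 2) ^ l a := by positivity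
      linarith
    obtain ⟨w, hw, hpre⟩ := exists_length_eq_not_prefix s c (l a)
      (fun x hx => (h1 x hx).trans_le (hmax x hx)) hlt
    have hne : ∀ x ∈ s, x ≠ a := fun x hx h => has (h ▸ hx)
    refine ⟨Function.update c a w, ?_, ?_⟩
    · intro x hx
      rcases Finset.mem_insert.1 hx with rfl | hx
      · simpa using hw
      · rw [Function.update_of_ne (hne x hx), h1 x hx]
    · intro x hx y hy h
      rcases Finset.mem_insert.1 hx with hxa | hx <;> rcases Finset.mem_insert.1 hy with hya | hy
      · rw [hxa, hya]
      · rw [hxa, Function.update_self, Function.update_of_ne (hne y hy)] at h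
        have hle := h.length_le
        have := h.eq_of_length (le_antisymm hle (by rw [h1 y hy, hw]; exact hmax y hy))
        exact absurd (this ▸ List.prefix_rfl) (hpre y hy)
      · rw [hya, Function.update_self, Function.update_of_ne (hne x hx)] at h
        exact absurd h (hpre x hx)
      · rw [Function.update_of_ne (hne x hx), Function.update_of_ne (hne y hy)] at h
        exact h2 x hx y hy h

variable (P : PMF 𝒳)

lemma huffmanLength_le {l : 𝒳 → ℕ} (h0 : ∀ x, 0 < l x) (h1 : ∑ x, ((1 : ℝ) / 2) ^ l x ≤ 1) :
    huffmanLength P ≤ ∑ x, (P x).toReal * (l x : ℝ) := by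
  refine csInf_le ⟨0, ?_⟩ ⟨l, h0, h1, rfl⟩
  rintro r ⟨l, -, -, rfl⟩
  positivity

/-- The minimum in the definition of the Huffman length is attained. -/
lemma exists_huffmanLength_eq (hP : ∀ x, P x ≠ 0) :
    ∃ l : 𝒳 → ℕ, (∀ x, 0 < l x) ∧ ∑ x, ((1 : ℝ) / 2) ^ l x ≤ 1 ∧
      huffmanLength P = ∑ x, (P x).toReal * (l x : ℝ) := by
  classical
  set A : Set ℝ := {r : ℝ | ∃ l : 𝒳 → ℕ, (∀ x, 0 < l x) ∧ ∑ x, ((1 : ℝ) / 2) ^ l x ≤ 1 ∧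
    r = ∑ x, (P x).toReal * (l x : ℝ)} with hA
  have hne : A.Nonempty := by
    -- A constant length that is positive and large enough for Kraft's inequality.
    refine ⟨_, fun _ => Fintype.card 𝒳 + 1, fun _ => Nat.succ_pos _, ?_, rfl⟩
    have h : (Fintype.card 𝒳 : ℝ) ≤ 2 ^ (Fintype.card 𝒳 + 1) := by
      exact_mod_cast (Nat.lt_two_pow_self.le.trans (Nat.pow_le_pow_right (by norm_num)
        (Nat.le_succ _)))
    simp only [Finset.sum_const, Finset.card_univ, nsmul_eq_mul, one_div, inv_pow]
    rw [← div_eq_mul_inv]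
    exact div_le_one_of_le₀ h (by positivity)
  obtain ⟨r₀, hr₀⟩ := hne
  have hpos : ∀ x, 0 < (P x).toReal := fun x => ENNReal.toReal_pos (hP x) (P.apply_ne_top x)
  -- As every symbol has positive mass, a cost of at most `r₀` bounds each length by `r₀ / P x`;
  -- only finitely many length functions remain.
  have hfin : (A ∩ Set.Iic r₀).Finite := by
    let F : Set (𝒳 → ℕ) := Set.univ.pi fun x => Set.Iic ⌊r₀ / (P x).toReal⌋₊
    have hF : F.Finite := Set.Finite.pi fun x => Set.finite_Iic _
    refine (hF.image fun l => ∑ x, (P x).toReal * (l x : ℝ)).subset ?_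
    rintro r ⟨⟨l, -, -, rfl⟩, hr⟩
    refine ⟨l, fun x _ => Nat.le_floor ?_, rfl⟩
    rw [le_div_iff₀ (hpos x), mul_comm]
    refine le_trans ?_ hr
    exact Finset.single_le_sum (f := fun x => (P x).toReal * (l x : ℝ))
      (fun y _ => by positivity) (Finset.mem_univ x)
  obtain ⟨m, ⟨hmA, hmr⟩, hmin⟩ := Set.exists_min_image (A ∩ Set.Iic r₀) id hfin
    ⟨r₀, hr₀, Set.mem_Iic.2 le_rfl⟩
  have hleast : IsLeast A m := by
    refine ⟨hmA, fun r hr => ?_⟩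
    rcases le_total r r₀ with h | h
    · exact hmin r ⟨hr, h⟩
    · exact le_trans hmr h
  obtain ⟨l, h0, h1, h2⟩ := hmA
  exact ⟨l, h0, h1, by rw [← h2]; exact hleast.csInf_eq⟩

end Kraft

/-! ### Measurability of countably valued histories -/

section Measurability

lemma measurableSet_of_forall_eq {Ω β : Type*} [MeasurableSpace Ω] [Countable β] {f : Ω → β}
    (hf : ∀ b, MeasurableSet {ω | f ω = b}) (s : Set β) : MeasurableSet {ω | f ω ∈ s} := by
  have : {ω | f ω ∈ s} = ⋃ b ∈ s, {ω | f ω = b} := by ext; simp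
  rw [this]
  exact MeasurableSet.biUnion s.to_countable fun b _ => hf b

lemma measurable_comp_of_forall_eq {Ω β γ : Type*} [MeasurableSpace Ω] [Countable β]
    [MeasurableSpace γ] {f : Ω → β} (hf : ∀ b, MeasurableSet {ω | f ω = b}) (g : β → γ) :
    Measurable fun ω => g (f ω) := by
  intro s _
  exact measurableSet_of_forall_eq hf (g ⁻¹' s)

lemma measurableSet_eq_prodMk {Ω β γ : Type*} [MeasurableSpace Ω] {f : Ω → β} {g : Ω → γ}
    (hf : ∀ b, MeasurableSet {ω | f ω = b}) (hg : ∀ c, MeasurableSet {ω | g ω = c}) (p : β × γ) :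
    MeasurableSet {ω | (f ω, g ω) = p} := by
  have : {ω | (f ω, g ω) = p} = {ω | f ω = p.1} ∩ {ω | g ω = p.2} := by
    ext; simp [Prod.ext_iff]
  rw [this]
  exact (hf _).inter (hg _)

/-- A function that, for each value `b` of a countably valued measurable map, agrees there with a
measurable function, is measurable. -/
lemma measurableSet_eq_of_cases {Ω β γ : Type*} [MeasurableSpace Ω] [Countable β] {f : Ω → β}
    (hf : ∀ b, MeasurableSet {ω | f ω = b}) {g : β → Ω → γ}
    (hg : ∀ b c, MeasurableSet {ω | g b ω = c}) (c : γ) :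
    MeasurableSet {ω | g (f ω) ω = c} := by
  have : {ω | g (f ω) ω = c} = ⋃ b, {ω | f ω = b} ∩ {ω | g b ω = c} := by ext; simp
  rw [this]
  exact MeasurableSet.iUnion fun b => (hf b).inter (hg b c)

lemma lintegral_eq_tsum_fiber {Ω β : Type*} [MeasurableSpace Ω] [Countable β] (μ : Measure Ω)
    {f : Ω → β} (hf : ∀ b, MeasurableSet {ω | f ω = b}) (g : Ω → ℝ≥0∞) :
    ∫⁻ ω, g ω ∂μ = ∑' b, ∫⁻ ω in {ω | f ω = b}, g ω ∂μ := by
  rw [← lintegral_iUnion hf]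
  · rw [show (⋃ b, {ω | f ω = b}) = Set.univ by ext; simp, Measure.restrict_univ]
  · intro b c hbc
    rw [Function.onFun, Set.disjoint_left]
    rintro ω rfl h
    exact hbc h

/-- Almost surely a countably valued random variable takes a value of positive probability. -/
lemma ae_measure_fiber_ne_zero {Ω β : Type*} [MeasurableSpace Ω] [Countable β] (μ : Measure Ω)
    (f : Ω → β) : ∀ᵐ ω ∂μ, μ {ω' | f ω' = f ω} ≠ 0 := by
  have : ∀ b, ∀ᵐ ω ∂μ, f ω = b → μ {ω' | f ω' = b} ≠ 0 := by
    intro b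
    by_cases h : μ {ω' | f ω' = b} = 0
    · have : ∀ᵐ ω ∂μ, ¬ f ω = b := by simpa [ae_iff] using h
      filter_upwards [this] with ω hω h' using absurd h' hω
    · exact Eventually.of_forall fun _ _ => h
  filter_upwards [ae_all_iff.2 this] with ω hω using hω (f ω) rfl

lemma measurableSet_firstBits_eq {Ω : Type*} [MeasurableSpace Ω] {u : Ω → ℕ → Bool}
    (hu : Measurable u) (j : ℕ) (k : Bits) : MeasurableSet {ω | firstBits (u ω) j = k} := by
  have hv : Measurable fun ω (i : Fin j) => u ω i :=
    measurable_pi_lambda _ fun i => (measurable_pi_apply _).comp hu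
  have : ∀ ω, firstBits (u ω) j = List.ofFn fun i : Fin j => u ω i := by
    intro ω
    apply List.ext_get <;> simp [firstBits]
  simp_rw [this]
  exact measurableSet_preimage hv (Set.toFinite {v | List.ofFn v = k}).measurableSet

variable {𝒳 V : Type*} [MeasurableSpace V] (E : Encoder 𝒳 V)

/-- Split according to the first halting index `m`. If the rule never halts, the segment has the
default value `[]`, which accounts for the last piece of the union. -/
lemma Encoder.measurableSet_segment_eq {Ω : Type*} [MeasurableSpace Ω]
    (ks : List Bits) {v : Ω → V} (hv : Measurable v) (xs : List 𝒳) {u : Ω → ℕ → Bool}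
    (hu : Measurable u) (k : Bits) : MeasurableSet {ω | E.segment ks (v ω) xs (u ω) = k} := by
  have hH : ∀ j, MeasurableSet {ω | E.halts ks (v ω) xs (firstBits (u ω) j)} := by
    intro j
    have : {ω | E.halts ks (v ω) xs (firstBits (u ω) j)} =
        ⋃ k, {ω | firstBits (u ω) j = k} ∩ v ⁻¹' {v | E.halts ks v xs k} := by
      ext; simp
    rw [this]
    exact MeasurableSet.iUnion fun k => (measurableSet_firstBits_eq hu j k).inter
      (hv (E.measurableSet_halts ks xs k))
  have : {ω | E.segment ks (v ω) xs (u ω) = k} =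
      (⋃ m, ({ω | E.halts ks (v ω) xs (firstBits (u ω) m)} ∩
        ⋂ j ∈ Set.Iio m, {ω | E.halts ks (v ω) xs (firstBits (u ω) j)}ᶜ) ∩
          {ω | firstBits (u ω) m = k}) ∪
      ((⋂ j, {ω | E.halts ks (v ω) xs (firstBits (u ω) j)}ᶜ) ∩ {_ω | k = []}) := by
    ext ω
    simp only [Set.mem_ofPred_eq, Set.mem_union, Set.mem_iUnion, Set.mem_inter_iff, Set.mem_iInter,
      Set.mem_compl_iff, Set.mem_Iio]
    unfold Encoder.segment
    classical
    split_ifs with h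
    · constructor
      · intro hk
        exact Or.inl ⟨Nat.find h, ⟨Nat.find_spec h, fun j hj => Nat.find_min h hj⟩, by
          convert hk⟩
      · rintro (⟨m, ⟨h1, h2⟩, h3⟩ | ⟨h1, -⟩)
        · rw [← h3]
          have : Nat.find h = m := (Nat.find_eq_iff h).2 ⟨h1, h2⟩
          rw [← this]
        · exact absurd h (by simpa using h1)
    · constructor
      · intro hk
        exact Or.inr ⟨by simpa using h, hk.symm⟩
      · rintro (⟨m, ⟨h1, -⟩, -⟩ | ⟨-, h1⟩)
        · exact absurd ⟨m, h1⟩ h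
        · exact h1.symm
  rw [this]
  refine MeasurableSet.union (MeasurableSet.iUnion fun m => ((hH m).inter ?_).inter
    (measurableSet_firstBits_eq hu m k)) (MeasurableSet.inter ?_ (MeasurableSet.const _))
  · exact MeasurableSet.biInter (Set.to_countable _) fun j _ => (hH j).compl
  · exact MeasurableSet.iInter fun j => (hH j).compl

lemma Encoder.keys_succ (t : ℕ) (ω : Outcome 𝒳 V) :
    E.keys (t + 1) ω = E.keys t ω ++ [E.key t ω] := rfl

lemma Encoder.words_succ (t : ℕ) (ω : Outcome 𝒳 V) :
    E.words (t + 1) ω = E.words t ω ++ [E.word t ω] := by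
  simp [Encoder.words, List.range_succ]

lemma Encoder.stream_succ (t : ℕ) (ω : Outcome 𝒳 V) :
    E.stream (t + 1) ω = E.stream t ω ++ E.word t ω := by
  simp [Encoder.stream, Encoder.words_succ]

variable [MeasurableSpace 𝒳] [MeasurableSingletonClass 𝒳]

lemma measurableSet_sym_eq (t : ℕ) (x : 𝒳) :
    MeasurableSet {ω : Outcome 𝒳 V | sym t ω = x} := by
  have h : Measurable fun ω : Outcome 𝒳 V => ω.1 t :=
    (measurable_pi_apply t).comp measurable_fst
  exact measurableSet_preimage h (measurableSet_singleton x)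

variable [Fintype 𝒳]

lemma measurableSet_syms_eq (n : ℕ) (xs : List 𝒳) :
    MeasurableSet {ω : Outcome 𝒳 V | syms n ω = xs} := by
  have hv : Measurable fun (ω : Outcome 𝒳 V) (i : Fin n) => ω.1 i :=
    measurable_pi_lambda _ fun i => (measurable_pi_apply _).comp measurable_fst
  have : ∀ ω : Outcome 𝒳 V, syms n ω = List.ofFn fun i : Fin n => ω.1 i := by
    intro ω
    apply List.ext_get <;> simp [syms]
  simp_rw [this]
  exact measurableSet_preimage hv (Set.toFinite {v | List.ofFn v = xs}).measurableSet

lemma Encoder.measurableSet_key_of_keys {t : ℕ}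
    (h : ∀ ks, MeasurableSet {ω | E.keys t ω = ks}) (k : Bits) :
    MeasurableSet {ω | E.key t ω = k} := by
  refine measurableSet_eq_of_cases (f := fun ω => (E.keys t ω, syms (t + 1) ω))
    (g := fun p ω => E.segment p.1 (ω.2.2 t) p.2 fun i => ω.2.1 (p.1.flatten.length + i))
    (measurableSet_eq_prodMk h (measurableSet_syms_eq _)) (fun p k => ?_) k
  refine E.measurableSet_segment_eq p.1 ?_ p.2 ?_ k
  · exact (measurable_pi_apply t).comp (measurable_snd.comp measurable_snd)
  · exact measurable_pi_lambda _ fun i =>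
      (measurable_pi_apply _).comp (measurable_fst.comp measurable_snd)

lemma Encoder.measurableSet_keys_eq (t : ℕ) (ks : List Bits) :
    MeasurableSet {ω | E.keys t ω = ks} := by
  induction t generalizing ks with
  | zero => exact MeasurableSet.const ([] = ks)
  | succ t ih =>
    simp_rw [E.keys_succ]
    exact measurableSet_of_forall_eq (f := fun ω => (E.keys t ω, E.key t ω))
      (measurableSet_eq_prodMk ih (E.measurableSet_key_of_keys ih)) {p | p.1 ++ [p.2] = ks}

lemma Encoder.measurableSet_word_eq (t : ℕ) (z : Bits) : MeasurableSet {ω | E.word t ω = z} := by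
  refine measurableSet_eq_of_cases (f := fun ω => (E.keys (t + 1) ω, syms (t + 1) ω))
    (g := fun p (ω : Outcome 𝒳 V) => E.code p.1 (ω.2.2 t) p.2)
    (measurableSet_eq_prodMk (E.measurableSet_keys_eq _) (measurableSet_syms_eq _))
    (fun p z => ?_) z
  have h : Measurable fun ω : Outcome 𝒳 V => ω.2.2 t :=
    (measurable_pi_apply t).comp (measurable_snd.comp measurable_snd)
  exact measurableSet_preimage h (E.measurableSet_code p.1 p.2 z)

lemma Encoder.measurableSet_stream_eq (n : ℕ) (b : Bits) :
    MeasurableSet {ω | E.stream n ω = b} := by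
  induction n generalizing b with
  | zero => exact MeasurableSet.const ([] = b)
  | succ t ih =>
    simp_rw [E.stream_succ]
    exact measurableSet_of_forall_eq (f := fun ω => (E.stream t ω, E.word t ω))
      (measurableSet_eq_prodMk ih (E.measurableSet_word_eq t)) {p | p.1 ++ p.2 = b}

lemma Encoder.measurableSet_view_eq (n t : ℕ) (y : Bits × List Bits) :
    MeasurableSet {ω | (E.stream n ω, E.keys t ω) = y} :=
  measurableSet_eq_prodMk (E.measurableSet_stream_eq n) (E.measurableSet_keys_eq t) y

end Measurability

/-! ### What the instantaneous decoder forces on comparable keys and words -/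

section Prefixes

lemma length_firstBits (u : ℕ → Bool) (j : ℕ) : (firstBits u j).length = j := by
  simp [firstBits]

lemma firstBits_prefix (u : ℕ → Bool) {i j : ℕ} (h : i ≤ j) : firstBits u i <+: firstBits u j := by
  obtain ⟨d, rfl⟩ := Nat.exists_eq_add_of_le h
  exact ⟨(List.range d).map fun k => u (i + k), by simp [firstBits, List.range_add]⟩

lemma syms_congr {𝒳 V : Type*} {n : ℕ} {ω ω' : Outcome 𝒳 V} (h : ∀ i < n, ω.1 i = ω'.1 i) :
    syms n ω = syms n ω' :=
  List.map_congr_left fun i hi => h i (List.mem_range.1 hi)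

variable {𝒳 V : Type*} [MeasurableSpace V] (E : Encoder 𝒳 V)

lemma Encoder.exists_segment_eq (ks : List Bits) (v : V) (xs : List 𝒳) (u : ℕ → Bool) :
    ∃ j, E.segment ks v xs u = firstBits u j := by
  unfold Encoder.segment
  split_ifs with h
  · exact ⟨_, rfl⟩
  · exact ⟨0, rfl⟩

lemma Encoder.segment_prefix_or (ks : List Bits) (v v' : V) (xs xs' : List 𝒳) (u : ℕ → Bool) :
    E.segment ks v xs u <+: E.segment ks v' xs' u ∨
      E.segment ks v' xs' u <+: E.segment ks v xs u := by
  obtain ⟨i, hi⟩ := E.exists_segment_eq ks v xs u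
  obtain ⟨j, hj⟩ := E.exists_segment_eq ks v' xs' u
  rw [hi, hj]
  exact (le_total i j).imp (firstBits_prefix u) (firstBits_prefix u)

lemma Encoder.stream_prefix {t n : ℕ} (h : t ≤ n) (ω : Outcome 𝒳 V) :
    E.stream t ω <+: E.stream n ω := by
  induction n, h using Nat.le_induction with
  | base => exact List.prefix_rfl
  | succ n _ ih => exact ih.trans (E.stream_succ n ω ▸ List.prefix_append _ _)

/-- The past keys do not depend on the present symbol. -/
lemma Encoder.keys_congr {n : ℕ} {ω ω' : Outcome 𝒳 V} (h : ∀ i < n, ω.1 i = ω'.1 i)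
    (h' : ω.2 = ω'.2) : E.keys n ω = E.keys n ω' := by
  induction n with
  | zero => rfl
  | succ n ih =>
    have hk := ih fun i hi => h i (hi.trans n.lt_succ_self)
    rw [E.keys_succ, E.keys_succ, hk, Encoder.key, Encoder.key, hk, syms_congr h, h']

lemma Encoder.words_congr {n : ℕ} {ω ω' : Outcome 𝒳 V} (h : ∀ i < n, ω.1 i = ω'.1 i)
    (h' : ω.2 = ω'.2) : E.words n ω = E.words n ω' := by
  refine List.map_congr_left fun t ht => ?_
  have ht : ∀ i < t + 1, ω.1 i = ω'.1 i := fun i hi =>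
    h i (lt_of_lt_of_le hi (List.mem_range.1 ht))
  rw [Encoder.word, Encoder.word, E.keys_congr ht h', syms_congr ht, h']

/-- The decoder follows the encoder in all stages of the outcome `ω`. -/
def Encoder.Correct (D : Decoder 𝒳) (ω : Outcome 𝒳 V) : Prop :=
  ∀ t, (E.key t ω, E.word t ω) ∈ D.accept (E.keys t ω) (E.words t ω) ∧
    D.out (E.keys (t + 1) ω) (E.words (t + 1) ω) = sym t ω

variable {E} {D : Decoder 𝒳} {ω ω' : Outcome 𝒳 V}

/-- Two correctly decoded outcomes with the same history and comparable keys and codewords in stage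
`t` have the same symbol in stage `t`. -/
lemma Encoder.Correct.sym_eq (h : E.Correct D ω) (h' : E.Correct D ω') {t : ℕ}
    (hk : E.keys t ω = E.keys t ω') (hw : E.words t ω = E.words t ω')
    (hkey : E.key t ω <+: E.key t ω' ∨ E.key t ω' <+: E.key t ω)
    (hword : E.word t ω <+: E.word t ω' ∨ E.word t ω' <+: E.word t ω) :
    sym t ω = sym t ω' := by
  have := D.instantaneous _ _ _ (h t).1 _ (hk ▸ hw ▸ (h' t).1) hkey hword
  rw [Prod.mk.injEq] at this
  rw [← (h t).2, ← (h' t).2, E.keys_succ, E.keys_succ, E.words_succ, E.words_succ, hk, hw,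
    this.1, this.2]

/-- After the common past, both words are prefixes of what remains of the same stream. The condition
`t < n` ensures that the stream contains the word of stage `t`. -/
lemma Encoder.word_prefix_or {t n : ℕ} (ht : t < n) (hs : E.stream n ω = E.stream n ω')
    (hw : E.words t ω = E.words t ω') :
    E.word t ω <+: E.word t ω' ∨ E.word t ω' <+: E.word t ω := by
  have h1 := E.stream_prefix ht ω
  have h2 := E.stream_prefix ht ω'
  rw [← hs] at h2
  rw [E.stream_succ] at h1 h2
  have h3 : E.stream t ω = E.stream t ω' := congrArg List.flatten hw
  rw [← h3] at h2
  exact (List.prefix_or_prefix_of_prefix h1 h2).imp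
    (List.prefix_append_right_inj _).1 (List.prefix_append_right_inj _).1

/-- The past keys and the bit stream determine the past codewords. -/
lemma Encoder.Correct.words_eq (h : E.Correct D ω) (h' : E.Correct D ω') {t n : ℕ} (ht : t ≤ n)
    (hs : E.stream n ω = E.stream n ω') (hk : E.keys t ω = E.keys t ω') :
    E.words t ω = E.words t ω' := by
  induction t with
  | zero => rfl
  | succ t ih =>
    rw [E.keys_succ, E.keys_succ] at hk
    obtain ⟨hk, hkey⟩ := List.append_inj' hk rfl
    have hkey : E.key t ω = E.key t ω' := by simpa using hkey
    have hw := ih (Nat.le_of_succ_le ht) hk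
    have := D.instantaneous _ _ _ (h t).1 _ (hk ▸ hw ▸ (h' t).1)
      (Or.inl (hkey ▸ List.prefix_rfl)) (E.word_prefix_or ht hs hw)
    rw [Prod.mk.injEq] at this
    rw [E.words_succ, E.words_succ, hw, this.2]

lemma Encoder.Correct.sym_eq_of_key_prefix (h : E.Correct D ω) (h' : E.Correct D ω') {t n : ℕ}
    (ht : t < n) (hs : E.stream n ω = E.stream n ω') (hk : E.keys t ω = E.keys t ω')
    (hkey : E.key t ω <+: E.key t ω') : sym t ω = sym t ω' :=
  have hw := h.words_eq h' ht.le hs hk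
  h.sym_eq h' hk hw (Or.inl hkey) (E.word_prefix_or ht hs hw)

end Prefixes

/-! ### Redrawing one source symbol -/

section Resampling

instance : IsProbabilityMeasure coin := PMF.toMeasure.isProbabilityMeasure _

instance : IsProbabilityMeasure keyLaw := by unfold keyLaw; infer_instance

variable {𝒳 V : Type*} [MeasurableSpace 𝒳] [MeasurableSpace V]

instance (P : PMF 𝒳) (ν : Measure V) [IsProbabilityMeasure ν] :
    IsProbabilityMeasure (law P ν) := by unfold law; infer_instance

/-- Replacing one coordinate of an i.i.d. sequence by an independent copy preserves its law. -/
lemma measurePreserving_update {ι : Type*} [DecidableEq ι] (π : Measure 𝒳)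
    [IsProbabilityMeasure π] (t : ι) :
    MeasurePreserving (fun p : (ι → 𝒳) × 𝒳 => Function.update p.1 t p.2)
      ((Measure.infinitePi fun _ => π).prod π) (Measure.infinitePi fun _ => π) := by
  have hm : Measurable fun p : (ι → 𝒳) × 𝒳 => Function.update p.1 t p.2 := by
    refine measurable_pi_lambda _ fun i => ?_
    by_cases h : i = t
    · subst h
      simpa using measurable_snd
    · simp only [Function.update_of_ne h]
      exact (measurable_pi_apply i).comp measurable_fst
  refine ⟨hm, Measure.eq_infinitePi _ fun s A hA => ?_⟩
  rw [Measure.map_apply hm (MeasurableSet.pi s.countable_toSet fun i _ => hA i)]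
  by_cases hts : t ∈ s
  · have : (fun p : (ι → 𝒳) × 𝒳 => Function.update p.1 t p.2) ⁻¹' (Set.pi s A) =
        (Set.pi (s.erase t : Finset ι) A) ×ˢ A t := by
      ext p
      simp only [Set.mem_preimage, Set.mem_pi, Set.mem_prod, Finset.mem_coe, Finset.mem_erase]
      constructor
      · intro h
        exact ⟨fun i hi => by simpa [Function.update_of_ne hi.1] using h i hi.2,
          by simpa using h t hts⟩
      · rintro ⟨h1, h2⟩ i hi
        by_cases h : i = t
        · subst h; simpa using h2
        · simpa [Function.update_of_ne h] using h1 i ⟨h, hi⟩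
    rw [this, Measure.prod_prod, Measure.infinitePi_pi _ fun i _ => hA i, mul_comm,
      Finset.mul_prod_erase s (fun i => π (A i)) hts]
  · have : (fun p : (ι → 𝒳) × 𝒳 => Function.update p.1 t p.2) ⁻¹' (Set.pi s A) =
        (Set.pi s A) ×ˢ Set.univ := by
      ext p
      simp only [Set.mem_preimage, Set.mem_pi, Set.mem_prod, Finset.mem_coe, Set.mem_univ,
        and_true]
      refine forall₂_congr fun i hi => ?_
      rw [Function.update_of_ne (ne_of_mem_of_not_mem hi hts)]
    rw [this, Measure.prod_prod, Measure.infinitePi_pi _ fun i _ => hA i, measure_univ, mul_one]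

/-- The outcome `ω` with the symbol of stage `t` replaced by `x`. -/
def resample (t : ℕ) (ω : Outcome 𝒳 V) (x : 𝒳) : Outcome 𝒳 V := (Function.update ω.1 t x, ω.2)

lemma measurePreserving_resample (P : PMF 𝒳) (ν : Measure V) [IsProbabilityMeasure ν] (t : ℕ) :
    MeasurePreserving (fun p : Outcome 𝒳 V × 𝒳 => resample t p.1 p.2)
      ((law P ν).prod P.toMeasure) (law P ν) := by
  have h1 := measurePreserving_prodAssoc (Measure.infinitePi fun _ : ℕ => P.toMeasure)
    (keyLaw.prod (Measure.infinitePi fun _ : ℕ => ν)) P.toMeasure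
  have h2 := (MeasurePreserving.id (Measure.infinitePi fun _ : ℕ => P.toMeasure)).prod
    (Measure.measurePreserving_swap
      (μ := keyLaw.prod (Measure.infinitePi fun _ : ℕ => ν)) (ν := P.toMeasure))
  have h3 := (measurePreserving_prodAssoc (Measure.infinitePi fun _ : ℕ => P.toMeasure)
    P.toMeasure (keyLaw.prod (Measure.infinitePi fun _ : ℕ => ν))).symm
  have h4 := (measurePreserving_update P.toMeasure t).prod
    (MeasurePreserving.id (keyLaw.prod (Measure.infinitePi fun _ : ℕ => ν)))
  exact h4.comp (h3.comp (h2.comp h1))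

end Resampling

/-! ### Rates as averages over stages -/

section Rates

variable {𝒳 V : Type*} [Fintype 𝒳] [MeasurableSpace 𝒳] [MeasurableSingletonClass 𝒳]
  [MeasurableSpace V] (E : Encoder 𝒳 V) (μ : Measure (Outcome 𝒳 V))

lemma Encoder.rate_eq : E.rate μ = limsup (fun n : ℕ =>
    (∑ t ∈ Finset.range n, ∫⁻ ω, ((E.word t ω).length : ℝ≥0∞) ∂μ) / (n : ℝ≥0∞)) atTop := by
  unfold Encoder.rate
  congr with n
  rw [← lintegral_finsetSum _ fun t _ =>
    measurable_comp_of_forall_eq (E.measurableSet_word_eq t) fun z => (z.length : ℝ≥0∞)]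
  congr with ω
  induction n with
  | zero => simp [Encoder.stream, Encoder.words]
  | succ n ih => rw [E.stream_succ, Finset.sum_range_succ, ← ih]; simp

lemma le_limsup_average {a : ℕ → ℝ≥0∞} {L : ℝ≥0∞} (h : ∀ t, L ≤ a t) :
    L ≤ limsup (fun n : ℕ => (∑ t ∈ Finset.range n, a t) / (n : ℝ≥0∞)) atTop := by
  refine le_limsup_of_frequently_le (Eventually.frequently ?_)
  filter_upwards [eventually_gt_atTop 0] with n hn
  rw [ENNReal.le_div_iff_mul_le (by simp [hn.ne']) (by simp)]
  calc L * n = ∑ t ∈ Finset.range n, L := by simp [mul_comm]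
    _ ≤ _ := Finset.sum_le_sum fun t _ => h t

end Rates

/-! ### Lower bound for the encoder rate -/

section EncoderConverse

/-- The codewords of the symbols of one stage, with everything else fixed, are prefix-free. -/
lemma Encoder.word_resample_prefixFree {𝒳 V : Type*} [MeasurableSpace V]
    {E : Encoder 𝒳 V} {D : Decoder 𝒳} {t : ℕ} {ω : Outcome 𝒳 V}
    (h : ∀ x, E.Correct D (resample t ω x)) (x y : 𝒳)
    (hxy : E.word t (resample t ω x) <+: E.word t (resample t ω y)) : x = y := by
  have hagree : ∀ i < t, (resample t ω x).1 i = (resample t ω y).1 i := by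
    intro i hi
    simp [resample, Function.update_of_ne hi.ne]
  have hk := E.keys_congr hagree rfl
  have hw := E.words_congr hagree rfl
  have hkey : E.key t (resample t ω x) <+: E.key t (resample t ω y) ∨
      E.key t (resample t ω y) <+: E.key t (resample t ω x) := by
    unfold Encoder.key
    rw [hk]
    exact E.segment_prefix_or _ _ _ _ _ _
  have := (h x).sym_eq (h y) hk hw hkey (Or.inl hxy)
  simpa [sym, resample] using this

variable {𝒳 V : Type*} [Fintype 𝒳] [Nontrivial 𝒳] [MeasurableSpace 𝒳]
  [MeasurableSingletonClass 𝒳] [MeasurableSpace V] {P : PMF 𝒳} {ν : Measure V}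
  [IsProbabilityMeasure ν] {E : Encoder 𝒳 V} {D : Decoder 𝒳}

/-- In every stage of a lossless code the expected codeword length is at least the Huffman
length. -/
lemma huffmanLength_le_lintegral_word (hP : ∀ x, P x ≠ 0) (hD : Lossless E (law P ν) D) (t : ℕ) :
    ENNReal.ofReal (huffmanLength P) ≤ ∫⁻ ω, ((E.word t ω).length : ℝ≥0∞) ∂law P ν := by
  have hmp := measurePreserving_resample P ν t
  have hmeas : Measurable fun ω : Outcome 𝒳 V => ((E.word t ω).length : ℝ≥0∞) :=
    measurable_comp_of_forall_eq (E.measurableSet_word_eq t) fun z => (z.length : ℝ≥0∞)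
  -- Since every symbol has positive mass, "almost every replacement" is the same as "every
  -- replacement".
  have hcorrect : ∀ᵐ ω ∂law P ν, ∀ x, E.Correct D (resample t ω x) := by
    have h1 : ∀ᵐ ω ∂law P ν, ∀ᵐ x ∂P.toMeasure, E.Correct D (resample t ω x) :=
      Measure.ae_ae_of_ae_prod (hmp.quasiMeasurePreserving.ae hD)
    filter_upwards [h1] with ω hω x
    by_contra hx
    have h2 : P.toMeasure {x} = 0 := measure_mono_null (Set.singleton_subset_iff.2 hx) hω
    rw [PMF.toMeasure_apply_singleton _ _ (measurableSet_singleton x)] at h2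
    exact hP x h2
  rw [← hmp.lintegral_comp hmeas,
    lintegral_prod (fun p : Outcome 𝒳 V × 𝒳 => ((E.word t (resample t p.1 p.2)).length : ℝ≥0∞))
      (hmeas.comp hmp.measurable).aemeasurable]
  calc ENNReal.ofReal (huffmanLength P)
      = ∫⁻ _, ENNReal.ofReal (huffmanLength P) ∂law P ν := by simp
    _ ≤ _ := lintegral_mono_ae ?_
  filter_upwards [hcorrect] with ω hω
  have hpf := E.word_resample_prefixFree hω
  rw [lintegral_fintype]
  refine (ENNReal.ofReal_le_ofReal (huffmanLength_le P (length_pos_of_prefixFree hpf)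
    (kraft_of_prefixFree hpf))).trans_eq ?_
  rw [ENNReal.ofReal_sum_of_nonneg fun _ _ => by positivity]
  refine Finset.sum_congr rfl fun x _ => ?_
  rw [PMF.toMeasure_apply_singleton _ _ (measurableSet_singleton x),
    ENNReal.ofReal_mul ENNReal.toReal_nonneg, ENNReal.ofReal_toReal (P.apply_ne_top x),
    ENNReal.ofReal_natCast, mul_comm]

end EncoderConverse

/-! ### Lower bound for the key rate -/

section KeyConverse

variable {𝒳 V : Type*} [MeasurableSpace 𝒳] [MeasurableSpace V]

/-- What an eavesdropper knows who, after `n` stages, is told the first `t` key segments. -/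
noncomputable def Encoder.view (E : Encoder 𝒳 V) (n t : ℕ) (ω : Outcome 𝒳 V) : Bits × List Bits :=
  (E.stream n ω, E.keys t ω)

lemma Encoder.posteriorKey_eq (E : Encoder 𝒳 V) (μ : Measure (Outcome 𝒳 V)) (t : ℕ) (x : 𝒳) (n : ℕ)
    (ω : Outcome 𝒳 V) : E.posteriorKey μ t x n ω =
      (μ[|{ω' | E.view n t ω' = E.view n t ω}]).real {ω' | sym t ω' = x} := by
  simp only [Encoder.posteriorKey, Encoder.view, Prod.mk.injEq]

/-- The view with no keys revealed; so results on `Encoder.view` cover both posteriors. -/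
lemma Encoder.posterior_eq (E : Encoder 𝒳 V) (μ : Measure (Outcome 𝒳 V)) (t : ℕ) (x : 𝒳) (n : ℕ)
    (ω : Outcome 𝒳 V) : E.posterior μ t x n ω =
      (μ[|{ω' | E.view n 0 ω' = E.view n 0 ω}]).real {ω' | sym t ω' = x} := by
  simp [Encoder.posterior, Encoder.view, Encoder.keys]

variable [Fintype 𝒳] [MeasurableSingletonClass 𝒳] {P : PMF 𝒳} {E : Encoder 𝒳 V} {D : Decoder 𝒳}
  {μ : Measure (Outcome 𝒳 V)}

/-- If the posterior of `X_t` dominates `c • P`, then the expected key length in stage `t` is at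
least `c` times the Huffman length. -/
lemma ofReal_mul_measure_le_setLIntegral_key [Nontrivial 𝒳] [IsProbabilityMeasure μ]
    (hP : ∀ x, P x ≠ 0) (hD : Lossless E μ D)
    {t n : ℕ} (ht : t < n) (y : Bits × List Bits) {c : ℝ} (hc : 0 ≤ c)
    (hcP : ∀ x, c * (P x).toReal ≤ (μ[|{ω | E.view n t ω = y}]).real {ω | sym t ω = x}) :
    ENNReal.ofReal (c * huffmanLength P) * μ {ω | E.view n t ω = y} ≤
      ∫⁻ ω in {ω | E.view n t ω = y}, ((E.key t ω).length : ℝ≥0∞) ∂μ := by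
  set S := {ω | E.view n t ω = y} with hS
  have hSm : MeasurableSet S := E.measurableSet_view_eq n t y
  -- For `c = 0` the bound is trivial. For `c > 0` every symbol has positive posterior, so each set
  -- `A x` below contains a correctly decoded outcome.
  rcases hc.eq_or_lt with rfl | hc
  · simp
  let A : 𝒳 → Set (Outcome 𝒳 V) := fun x => {ω | E.Correct D ω ∧ ω ∈ S ∧ sym t ω = x}
  have hA : ∀ x, (A x).Nonempty := by
    intro x
    have h1 : 0 < (μ[|S]).real {ω | sym t ω = x} :=
      (mul_pos hc (ENNReal.toReal_pos (hP x) (P.apply_ne_top x))).trans_le (hcP x)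
    have h2 : μ (S ∩ {ω | sym t ω = x}) ≠ 0 := by
      intro h
      rw [Measure.real, cond_apply hSm, h] at h1
      simp at h1
    obtain ⟨ω, hω, hcor⟩ := Measure.exists_mem_of_measure_ne_zero_of_ae h2 (ae_restrict_of_ae hD)
    exact ⟨ω, hcor, hω.1, hω.2⟩
  -- Private randomness and later symbols may vary the key of a symbol within the fibre; the
  -- shortest one represents it and bounds the others from below.
  have hmin : ∀ x, ∃ ω ∈ A x, ∀ ω' ∈ A x, (E.key t ω).length ≤ (E.key t ω').length := by
    intro x
    obtain ⟨ω, hω, h⟩ :=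
      (measure fun ω : Outcome 𝒳 V => (E.key t ω).length).wf.has_min (A x) (hA x)
    exact ⟨ω, hω, fun ω' hω' => not_lt.1 (h ω' hω')⟩
  choose w hwA hwmin using hmin
  have hpf : ∀ x x', E.key t (w x) <+: E.key t (w x') → x = x' := by
    intro x x' h
    have hv : E.view n t (w x) = E.view n t (w x') := (hwA x).2.1.trans (hwA x').2.1.symm
    simp only [Encoder.view, Prod.mk.injEq] at hv
    have := (hwA x).1.sym_eq_of_key_prefix (hwA x').1 ht hv.1 hv.2 h
    rwa [(hwA x).2.2, (hwA x').2.2] at this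
  have hL := huffmanLength_le P (length_pos_of_prefixFree hpf) (kraft_of_prefixFree hpf)
  rw [lintegral_eq_tsum_fiber (μ.restrict S) (measurableSet_sym_eq t), tsum_fintype]
  calc ENNReal.ofReal (c * huffmanLength P) * μ S
      ≤ ENNReal.ofReal (∑ x, (μ[|S]).real {ω | sym t ω = x} * ((E.key t (w x)).length : ℝ)) *
          μ S := by
        gcongr
        refine (mul_le_mul_of_nonneg_left hL hc.le).trans ?_
        rw [Finset.mul_sum]
        refine Finset.sum_le_sum fun x _ => ?_
        rw [← mul_assoc]
        exact mul_le_mul_of_nonneg_right (hcP x) (by positivity)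
    _ = ∑ x, ((E.key t (w x)).length : ℝ≥0∞) * μ (S ∩ {ω | sym t ω = x}) := by
        rw [ENNReal.ofReal_sum_of_nonneg fun _ _ => by positivity, Finset.sum_mul]
        refine Finset.sum_congr rfl fun x _ => ?_
        rw [ENNReal.ofReal_mul measureReal_nonneg, ofReal_measureReal, ENNReal.ofReal_natCast,
          ← cond_mul_eq_inter hSm]
        ring
    _ ≤ _ := by
        refine Finset.sum_le_sum fun x _ => ?_
        rw [Measure.restrict_restrict (measurableSet_sym_eq t x), Set.inter_comm,
          ← setLIntegral_const]
        refine setLIntegral_mono_ae' ((measurableSet_sym_eq t x).inter hSm) ?_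
        filter_upwards [hD] with ω hω h
        exact_mod_cast hwmin x ω ⟨hω, h.2, h.1⟩

/-- In every stage of a lossless and secret code whose past keys are asymptotically useless, the
expected key length is at least the Huffman length. -/
lemma huffmanLength_le_lintegral_key [Nontrivial 𝒳] [IsProbabilityMeasure μ]
    (hP : ∀ x, P x ≠ 0) (hD : Lossless E μ D) (hM : MarkovKeys E μ) (hS : Secret E μ P) (t : ℕ) :
    ENNReal.ofReal (huffmanLength P) ≤ ∫⁻ ω, ((E.key t ω).length : ℝ≥0∞) ∂μ := by
  have hpos : ∀ x, 0 < (P x).toReal := fun x => ENNReal.toReal_pos (hP x) (P.apply_ne_top x)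
  -- The largest factor for which the posterior dominates that multiple of `P`. It tends to `1`
  -- along almost every outcome.
  let C : ℕ → Bits × List Bits → ℝ := fun n y => Finset.univ.inf' Finset.univ_nonempty
    fun x => (μ[|{ω | E.view n t ω = y}]).real {ω | sym t ω = x} / (P x).toReal
  have hC0 : ∀ n y, 0 ≤ C n y := fun n y =>
    (Finset.le_inf'_iff _ _).2 fun x _ => by positivity
  have hCP : ∀ n y x,
      C n y * (P x).toReal ≤ (μ[|{ω | E.view n t ω = y}]).real {ω | sym t ω = x} := by
    intro n y x
    rw [← le_div_iff₀ (hpos x)]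
    exact Finset.inf'_le _ (Finset.mem_univ x)
  have hmeas : ∀ n, Measurable fun ω =>
      ENNReal.ofReal (C n (E.view n t ω) * huffmanLength P) := fun n =>
    measurable_comp_of_forall_eq (f := E.view n t) (E.measurableSet_view_eq n t)
      fun y => ENNReal.ofReal (C n y * huffmanLength P)
  have hlim : ∀ᵐ ω ∂μ, Tendsto
      (fun n => ENNReal.ofReal (C n (E.view n t ω) * huffmanLength P)) atTop
      (𝓝 (ENNReal.ofReal (huffmanLength P))) := by
    have h : ∀ᵐ ω ∂μ, ∀ x, Tendsto (fun n => E.posteriorKey μ t x n ω) atTop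
        (𝓝 (P x).toReal) := by
      rw [ae_all_iff]
      intro x
      filter_upwards [hM t x, hS t x] with ω h1 h2
      simpa using h1.add h2
    filter_upwards [h] with ω hω
    refine ENNReal.tendsto_ofReal ?_
    have h1 : Tendsto (fun n => C n (E.view n t ω)) atTop (𝓝 1) := by
      have : Tendsto (fun n => Finset.univ.inf' Finset.univ_nonempty
          fun x => E.posteriorKey μ t x n ω / (P x).toReal) atTop
          (𝓝 (Finset.univ.inf' Finset.univ_nonempty fun x : 𝒳 => (P x).toReal / (P x).toReal)) :=
        Tendsto.finset_inf'_nhds_apply _ fun x _ => (hω x).div_const _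
      simp only [Encoder.posteriorKey_eq] at this
      convert this using 2
      simp [div_self (hpos _).ne']
    simpa using h1.mul_const (huffmanLength P)
  have hbound : ∀ n, t < n → ∫⁻ ω, ENNReal.ofReal (C n (E.view n t ω) * huffmanLength P) ∂μ ≤
      ∫⁻ ω, ((E.key t ω).length : ℝ≥0∞) ∂μ := by
    intro n hn
    rw [lintegral_eq_tsum_fiber μ (E.measurableSet_view_eq n t),
      lintegral_eq_tsum_fiber μ (E.measurableSet_view_eq n t)]
    refine ENNReal.tsum_le_tsum fun y => ?_
    refine le_trans (le_of_eq ?_)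
      (ofReal_mul_measure_le_setLIntegral_key hP hD hn y (hC0 n y) (hCP n y))
    rw [← setLIntegral_const]
    refine setLIntegral_congr_fun (E.measurableSet_view_eq n t y) fun ω hω => ?_
    have : E.view n t ω = y := hω
    simp only [this]
  -- Fatou's lemma, applied to lower bounds that converge almost surely while the right side does
  -- not depend on `n`.
  calc ENNReal.ofReal (huffmanLength P)
      = ∫⁻ ω, liminf (fun n => ENNReal.ofReal (C n (E.view n t ω) * huffmanLength P)) atTop ∂μ := by
        rw [lintegral_congr_ae (g := fun _ => ENNReal.ofReal (huffmanLength P))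
          (hlim.mono fun ω h => h.liminf_eq)]
        simp
    _ ≤ liminf (fun n => ∫⁻ ω, ENNReal.ofReal (C n (E.view n t ω) * huffmanLength P) ∂μ) atTop :=
        lintegral_liminf_le hmeas
    _ ≤ _ := by
        refine liminf_le_of_frequently_le' (Eventually.frequently ?_)
        filter_upwards [eventually_gt_atTop t] with n hn using hbound n hn

end KeyConverse

/-! ### One-time pad on a prefix-free code -/

section OneTimePad

/-- The bitwise sum modulo 2 of two strings. -/
def xorBits (a b : Bits) : Bits := List.zipWith xor a b

lemma length_xorBits {a b : Bits} (h : a.length = b.length) :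
    (xorBits a b).length = a.length := by
  simp [xorBits, h]

lemma xorBits_xorBits {a b : Bits} (h : a.length = b.length) : xorBits (xorBits a b) b = a := by
  apply List.ext_getElem
  · simp [xorBits, h]
  · intro i h1 h2
    simp [xorBits]

lemma xorBits_prefix {a a' b b' : Bits} (h : a.length = b.length) (ha : a <+: a')
    (hb : b <+: b') : xorBits a b <+: xorBits a' b' := by
  obtain ⟨r, rfl⟩ := ha
  obtain ⟨r', rfl⟩ := hb
  exact ⟨xorBits r r', (List.zipWith_append h).symm⟩

variable {𝒳 : Type*} (c : 𝒳 → Bits)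

/-- The codeword of the last symbol of a list. -/
def lastWord (xs : List 𝒳) : Bits := (xs.getLast?.map c).getD []

/-- The encoder that adds to the codeword of each symbol a fresh key segment of the same length. -/
def padEncoder : Encoder 𝒳 Unit where
  halts _ _ xs k := k.length = (lastWord c xs).length
  code ks _ xs := xorBits (lastWord c xs) (ks.getLast?.getD [])
  halts_ae _ _ _ := Eventually.of_forall fun u => ⟨_, length_firstBits u _⟩
  measurableSet_halts _ _ _ := MeasurableSet.of_discrete
  measurableSet_code _ _ _ := MeasurableSet.of_discrete

/-- The decoder of `padEncoder`, for a prefix-free code. -/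
noncomputable def padDecoder [Nonempty 𝒳] (hc : ∀ x y, c x <+: c y → x = y) : Decoder 𝒳 where
  accept _ _ := {p | ∃ x, p.1.length = (c x).length ∧ p.2 = xorBits (c x) p.1}
  instantaneous _ _ := by
    -- The case where `k` is the shorter key. Words are as long as their keys, so comparable words
    -- are ordered like the keys; adding the keys back gives `c x <+: c y`.
    have key : ∀ x y k k', k.length = (c x).length → k'.length = (c y).length → k <+: k' →
        (xorBits (c x) k <+: xorBits (c y) k' ∨ xorBits (c y) k' <+: xorBits (c x) k) →
        (k, xorBits (c x) k) = (k', xorBits (c y) k') := by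
      intro x y k k' hx hy hk hz
      have hlen := hk.length_le
      have hlx := length_xorBits hx.symm
      have hly := length_xorBits hy.symm
      have hz : xorBits (c x) k <+: xorBits (c y) k' := by
        rcases hz with hz | hz
        · exact hz
        · rw [hz.eq_of_length (le_antisymm hz.length_le (by omega))]
      have h := xorBits_prefix (hlx.trans hx.symm) hz hk
      rw [xorBits_xorBits hx.symm, xorBits_xorBits hy.symm] at h
      obtain rfl := hc x y h
      obtain rfl := hk.eq_of_length (hx.trans hy.symm)
      rfl
    rintro ⟨k, z⟩ ⟨x, hx, hzx⟩ ⟨k', z'⟩ ⟨y, hy, hzy⟩ (hk | hk) hz <;>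
      dsimp only at hx hzx hy hzy hk hz <;> subst hzx hzy
    · exact key x y k k' hx hy hk hz
    · exact (key y x k' k hy hx hk hz.symm).symm
  out ks zs := Function.invFun c (xorBits (zs.getLast?.getD []) (ks.getLast?.getD []))

lemma lastWord_syms {V : Type*} (t : ℕ) (ω : Outcome 𝒳 V) :
    lastWord c (syms (t + 1) ω) = c (ω.1 t) := by
  simp [lastWord, syms, List.range_succ]

lemma padEncoder_segment (ks : List Bits) (v : Unit) (xs : List 𝒳) (u : ℕ → Bool) :
    (padEncoder c).segment ks v xs u = firstBits u (lastWord c xs).length := by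
  classical
  have h : ∃ j, (padEncoder c).halts ks v xs (firstBits u j) := ⟨_, length_firstBits u _⟩
  rw [Encoder.segment, dif_pos h]
  congr 1
  have h1 : (firstBits u (Nat.find h)).length = (lastWord c xs).length := Nat.find_spec h
  rw [length_firstBits] at h1
  convert h1

variable {c} (ω : Outcome 𝒳 Unit)

lemma padEncoder_key (t : ℕ) : (padEncoder c).key t ω =
    firstBits (fun i => ω.2.1 (((padEncoder c).keys t ω).flatten.length + i))
      (c (ω.1 t)).length := by
  rw [Encoder.key, padEncoder_segment, lastWord_syms]

lemma length_padEncoder_key (t : ℕ) :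
    ((padEncoder c).key t ω).length = (c (ω.1 t)).length := by
  rw [padEncoder_key, length_firstBits]

lemma padEncoder_word (t : ℕ) :
    (padEncoder c).word t ω = xorBits (c (ω.1 t)) ((padEncoder c).key t ω) := by
  rw [Encoder.word, Encoder.keys_succ]
  simp [padEncoder, lastWord_syms]

lemma length_padEncoder_word (t : ℕ) :
    ((padEncoder c).word t ω).length = (c (ω.1 t)).length := by
  rw [padEncoder_word, length_xorBits (length_padEncoder_key ω t).symm]

lemma lossless_pad [Nonempty 𝒳] [MeasurableSpace 𝒳] (hc : ∀ x y, c x <+: c y → x = y)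
    (μ : Measure (Outcome 𝒳 Unit)) : Lossless (padEncoder c) μ (padDecoder c hc) := by
  have hinj : Function.Injective c := fun x y h => hc x y (h ▸ List.prefix_rfl)
  refine Eventually.of_forall fun ω t =>
    ⟨⟨ω.1 t, length_padEncoder_key ω t, padEncoder_word ω t⟩, ?_⟩
  rw [Encoder.keys_succ, Encoder.words_succ, padEncoder_word]
  simp only [padDecoder, List.getLast?_append, List.getLast?_singleton, Option.some_or,
    Option.getD_some]
  rw [xorBits_xorBits (length_padEncoder_key ω t).symm]
  exact Function.leftInverse_invFun hinj _

variable (c)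

/-- The concatenation of the codewords of the first `n` symbols. -/
def codeStream (n : ℕ) (X : ℕ → 𝒳) : Bits := ((List.range n).map fun i => c (X i)).flatten

lemma codeStream_succ (n : ℕ) (X : ℕ → 𝒳) :
    codeStream c (n + 1) X = codeStream c n X ++ c (X n) := by
  simp [codeStream, List.range_succ]

lemma length_codeStream (n : ℕ) (X : ℕ → 𝒳) :
    (codeStream c n X).length = ∑ i ∈ Finset.range n, (c (X i)).length := by
  induction n with
  | zero => rfl
  | succ n ih => rw [codeStream_succ, List.length_append, ih, Finset.sum_range_succ]

lemma codeStream_prefix {s n : ℕ} (h : s ≤ n) (X : ℕ → 𝒳) :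
    codeStream c s X <+: codeStream c n X := by
  induction n, h using Nat.le_induction with
  | base => exact List.prefix_rfl
  | succ n _ ih => exact ih.trans (codeStream_succ c n X ▸ List.prefix_append _ _)

lemma codeStream_congr {n : ℕ} {X X' : ℕ → 𝒳} (h : ∀ i < n, X i = X' i) :
    codeStream c n X = codeStream c n X' := by
  unfold codeStream
  rw [List.map_congr_left fun i hi => by rw [h i (List.mem_range.1 hi)]]

lemma getD_of_prefix {a b : Bits} (h : a <+: b) {m : ℕ} (hm : m < a.length) :
    b.getD m false = a.getD m false := by
  obtain ⟨r, rfl⟩ := h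
  exact List.getD_append _ _ _ _ hm

variable {c}

lemma length_flatten_padEncoder_keys (n : ℕ) :
    ((padEncoder c).keys n ω).flatten.length = (codeStream c n ω.1).length := by
  induction n with
  | zero => rfl
  | succ n ih =>
    rw [Encoder.keys_succ, codeStream_succ, List.flatten_append, List.length_append,
      List.length_append, ih]
    simp [length_padEncoder_key]

lemma firstBits_add (u : ℕ → Bool) (i j : ℕ) :
    firstBits u (i + j) = firstBits u i ++ firstBits (fun k => u (i + k)) j := by
  simp [firstBits, List.range_add, Function.comp_def]

lemma firstBits_congr {u u' : ℕ → Bool} {j : ℕ} (h : ∀ i < j, u i = u' i) :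
    firstBits u j = firstBits u' j :=
  List.map_congr_left fun i hi => h i (List.mem_range.1 hi)

/-- The bit stream is the sum modulo 2 of the key sequence and the concatenated codewords. -/
lemma padEncoder_stream (n : ℕ) : (padEncoder c).stream n ω =
    firstBits (fun m => xor ((codeStream c n ω.1).getD m false) (ω.2.1 m))
      (codeStream c n ω.1).length := by
  induction n with
  | zero => rfl
  | succ n ih =>
    rw [Encoder.stream_succ, codeStream_succ, List.length_append, firstBits_add, ih]
    congr 1
    · refine firstBits_congr fun m hm => ?_
      rw [List.getD_append _ _ _ _ hm]
    · rw [padEncoder_word, padEncoder_key, length_flatten_padEncoder_keys]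
      apply List.ext_getElem
      · simp [xorBits, firstBits]
      · intro i h1 h2
        have h3 : i < (c (ω.1 n)).length := by simpa [firstBits] using h2
        simp [xorBits, firstBits, h3]

/-- The past keys depend only on the past symbols and on the key bits read so far. -/
lemma padEncoder_keys_congr {ω ω' : Outcome 𝒳 Unit} {s : ℕ} (hX : ∀ i < s, ω.1 i = ω'.1 i)
    (hu : ∀ m < (codeStream c s ω.1).length, ω.2.1 m = ω'.2.1 m) :
    (padEncoder c).keys s ω = (padEncoder c).keys s ω' := by
  induction s with
  | zero => rfl
  | succ s ih =>
    rw [codeStream_succ, List.length_append] at hu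
    have hk := ih (fun i hi => hX i (hi.trans s.lt_succ_self))
      (fun m hm => hu m (hm.trans_le (Nat.le_add_right _ _)))
    rw [Encoder.keys_succ, Encoder.keys_succ, padEncoder_key, padEncoder_key, ← hk,
      ← hX s s.lt_succ_self, length_flatten_padEncoder_keys]
    congr 2
    exact firstBits_congr fun i hi => hu _ (Nat.add_lt_add_left hi _)

end OneTimePad

/-! ### Exchange symmetry of the padded stream -/

section Exchange

variable {𝒳 : Type*}

/-- Swap the symbols of the stages `i` and `j` and change the key such that `padEncoder c` sends the
same stream in `n` stages. -/
def exchange (c : 𝒳 → Bits) (n i j : ℕ) (ω : Outcome 𝒳 Unit) : Outcome 𝒳 Unit :=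
  (ω.1 ∘ Equiv.swap i j,
    fun m => xor (ω.2.1 m) (xor ((codeStream c n ω.1).getD m false)
      ((codeStream c n (ω.1 ∘ Equiv.swap i j)).getD m false)), ω.2.2)

lemma view_exchange (c : 𝒳 → Bits) {s n i j : ℕ} (hi : i ∈ Set.Ico s n) (hj : j ∈ Set.Ico s n)
    (ω : Outcome 𝒳 Unit) :
    (padEncoder c).stream n (exchange c n i j ω) = (padEncoder c).stream n ω ∧
      (padEncoder c).keys s (exchange c n i j ω) = (padEncoder c).keys s ω := by
  have hX : ∀ k < s, (ω.1 ∘ Equiv.swap i j) k = ω.1 k := fun k hk => by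
    rw [Function.comp_apply, Equiv.swap_apply_of_ne_of_ne (hk.trans_le hi.1).ne
      (hk.trans_le hj.1).ne]
  -- The swap permutes the stages below `n`, so the total code length is unchanged although codeword
  -- boundaries may move.
  have hlen : (codeStream c n (ω.1 ∘ Equiv.swap i j)).length = (codeStream c n ω.1).length := by
    rw [length_codeStream, length_codeStream]
    refine Equiv.Perm.sum_comp (Equiv.swap i j) (Finset.range n)
      (fun k => (c (ω.1 k)).length) fun k hk => ?_
    have : k = i ∨ k = j := by
      by_contra! h
      exact hk (Equiv.swap_apply_of_ne_of_ne h.1 h.2)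
    rcases this with rfl | rfl
    · exact Finset.mem_coe.2 (Finset.mem_range.2 hi.2)
    · exact Finset.mem_coe.2 (Finset.mem_range.2 hj.2)
  constructor
  · rw [padEncoder_stream, padEncoder_stream]
    simp only [exchange]
    rw [hlen]
    refine firstBits_congr fun m _ => ?_
    cases ω.2.1 m <;> cases (codeStream c n ω.1).getD m false <;>
      cases (codeStream c n (ω.1 ∘ Equiv.swap i j)).getD m false <;> rfl
  · symm
    have hsn : s ≤ n := hi.1.trans hi.2.le
    refine padEncoder_keys_congr (fun k hk => (hX k hk).symm) fun m hm => ?_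
    -- Both code streams start with the codewords of the unmoved symbols before `s`, so the
    -- correction of the key vanishes on the bits used there.
    have h1 := getD_of_prefix (codeStream_prefix c hsn ω.1) hm
    have h2 := getD_of_prefix (codeStream_prefix c hsn (ω.1 ∘ Equiv.swap i j)) (m := m)
      (by rwa [codeStream_congr c hX])
    simp only [exchange]
    rw [h1, h2, codeStream_congr c hX]
    simp

variable [MeasurableSpace 𝒳]

lemma measurePreserving_comp_swap (π : Measure 𝒳) [IsProbabilityMeasure π] (i j : ℕ) :
    MeasurePreserving (fun X : ℕ → 𝒳 => X ∘ Equiv.swap i j)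
      (Measure.infinitePi fun _ => π) (Measure.infinitePi fun _ => π) :=
  ⟨measurable_pi_lambda _ fun _ => measurable_pi_apply _,
    Measure.map_infinitePi_infinitePi_of_inj (P := fun _ => π) (Equiv.swap i j).injective⟩

lemma coin_singleton (b : Bool) : coin {b} = 2⁻¹ := by
  simp [coin]

lemma map_xor_coin (d : Bool) : coin.map (fun b => xor b d) = coin := by
  refine Measure.ext_of_singleton fun b => ?_
  rw [Measure.map_apply (Measurable.of_discrete) (measurableSet_singleton b)]
  have : (fun b' => xor b' d) ⁻¹' {b} = {xor b d} := by
    ext b'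
    cases b <;> cases b' <;> cases d <;> simp
  rw [this, coin_singleton, coin_singleton]

lemma measurePreserving_xor_keyLaw (d : ℕ → Bool) :
    MeasurePreserving (fun (u : ℕ → Bool) m => xor (u m) (d m)) keyLaw keyLaw := by
  refine ⟨measurable_pi_lambda _ fun m =>
    (Measurable.of_discrete (f := fun b => xor b (d m))).comp (measurable_pi_apply m), ?_⟩
  unfold keyLaw
  rw [Measure.infinitePi_map_pi (f := fun m b => xor b (d m)) _
    (fun m => Measurable.of_discrete)]
  simp_rw [map_xor_coin]

variable [Fintype 𝒳] [MeasurableSingletonClass 𝒳]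

lemma measurable_codeStream_getD (c : 𝒳 → Bits) (n m : ℕ) :
    Measurable fun X : ℕ → 𝒳 => (codeStream c n X).getD m false := by
  have h : ∀ X : ℕ → 𝒳, codeStream c n X = (List.ofFn fun i : Fin n => c (X i)).flatten := by
    intro X
    unfold codeStream
    congr 1
    apply List.ext_get <;> simp
  simp_rw [h]
  exact (Measurable.of_discrete
    (f := fun x : Fin n → 𝒳 => (List.ofFn fun i => c (x i)).flatten.getD m false)).comp
    (measurable_pi_lambda _ fun i => measurable_pi_apply (i : ℕ))

/-- The swap preserves the i.i.d. source law, and for fixed symbols the key is xored with a fixed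
sequence, which preserves fair bits. -/
lemma measurePreserving_exchange (P : PMF 𝒳) (ν : Measure Unit) [IsProbabilityMeasure ν]
    (c : 𝒳 → Bits) (n i j : ℕ) :
    MeasurePreserving (exchange c n i j) (law P ν) (law P ν) := by
  have hswap := measurePreserving_comp_swap P.toMeasure i j
  refine MeasurePreserving.skew_product hswap
    (g := fun X (r : (ℕ → Bool) × (ℕ → Unit)) => (fun m => xor (r.1 m) (xor ((codeStream c n X).getD m false)
      ((codeStream c n (X ∘ Equiv.swap i j)).getD m false)), r.2)) ?_ ?_
  · refine Measurable.prodMk (measurable_pi_lambda _ fun m => ?_)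
      (measurable_snd.comp measurable_snd)
    have hxor : Measurable fun q : Bool × Bool × Bool => xor q.1 (xor q.2.1 q.2.2) :=
      Measurable.of_discrete
    have h1 : Measurable fun p : Outcome 𝒳 Unit => (codeStream c n p.1).getD m false :=
      (measurable_codeStream_getD c n m).comp measurable_fst
    have h2 : Measurable fun p : Outcome 𝒳 Unit =>
        (codeStream c n (p.1 ∘ Equiv.swap i j)).getD m false :=
      (measurable_codeStream_getD c n m).comp (hswap.measurable.comp measurable_fst)
    have h3 : Measurable fun p : Outcome 𝒳 Unit => p.2.1 m :=
      (measurable_pi_apply m).comp (measurable_fst.comp measurable_snd)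
    exact hxor.comp (h3.prodMk (h1.prodMk h2))
  · exact Eventually.of_forall fun X => ((measurePreserving_xor_keyLaw _).prod
      (MeasurePreserving.id _)).map_eq

/-- Given the stream of `n` stages and the first `s` keys of `padEncoder c`, the symbols of the
stages `s, …, n - 1` have the same conditional law. -/
lemma cond_view_sym_eq (P : PMF 𝒳) (ν : Measure Unit) [IsProbabilityMeasure ν]
    (c : 𝒳 → Bits) {s n i j : ℕ} (hi : i ∈ Set.Ico s n) (hj : j ∈ Set.Ico s n)
    (y : Bits × List Bits) (x : 𝒳) :
    ((law P ν)[|{ω | (padEncoder c).view n s ω = y}]).real {ω | sym i ω = x} =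
      ((law P ν)[|{ω | (padEncoder c).view n s ω = y}]).real {ω | sym j ω = x} := by
  have hS := (padEncoder c).measurableSet_view_eq n s y
  have hmp := measurePreserving_exchange P ν c n i j
  have hS' : MeasurableSet {ω : Outcome 𝒳 Unit | (padEncoder c).view n s ω = y} := hS
  rw [Measure.real, Measure.real, cond_apply hS', cond_apply hS',
    ← hmp.measure_preimage (hS'.inter (measurableSet_sym_eq i x)).nullMeasurableSet]
  congr 3
  ext ω
  obtain ⟨h1, h2⟩ := view_exchange c hi hj ω
  simp only [Set.mem_preimage, Set.mem_inter_iff, Set.mem_ofPred_eq, Encoder.view, h1, h2]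
  simp [sym, exchange]

end Exchange

/-! ### Conditional means under non-nested observations -/

section ConditionalConvergence

variable {Ω β : Type*} [MeasurableSpace Ω] [Countable β] {μ : Measure Ω} [IsProbabilityMeasure μ]

/-- The law of total probability for a countably valued random variable. -/
lemma lintegral_cond_fiber {f : Ω → β} (hf : ∀ b, MeasurableSet {ω | f ω = b}) (A : Set Ω) :
    ∫⁻ ω, (μ[|{ω' | f ω' = f ω}]) A ∂μ = μ A := by
  rw [lintegral_eq_tsum_fiber μ hf]
  calc ∑' b, ∫⁻ ω in {ω | f ω = b}, (μ[|{ω' | f ω' = f ω}]) A ∂μ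
      = ∑' b, μ.restrict A {ω | f ω = b} := by
        congr with b
        rw [setLIntegral_congr_fun (hf b) (g := fun _ => (μ[|{ω | f ω = b}]) A) (by
          intro ω (hω : f ω = b)
          simp only [hω]), setLIntegral_const, cond_mul_eq_inter (hf b),
          Measure.restrict_apply (hf b)]
    _ = μ A := by
        have h := lintegral_eq_tsum_fiber (μ.restrict A) hf 1
        simpa using h.symm

lemma abs_integral_le_add_measure (κ : Measure Ω) [IsProbabilityMeasure κ] {f : Ω → ℝ}
    (hf : Measurable f) (hf1 : ∀ ω, |f ω| ≤ 1) {ε : ℝ} (hε : 0 ≤ ε) :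
    |∫ ω, f ω ∂κ| ≤ ε + κ.real {ω | ε ≤ |f ω|} := by
  have hA : MeasurableSet {ω | ε ≤ |f ω|} := measurableSet_le measurable_const hf.abs
  have hint : Integrable (fun ω => {ω | ε ≤ |f ω|}.indicator (fun _ => (1 : ℝ)) ω) κ :=
    (integrable_const 1).indicator hA
  calc |∫ ω, f ω ∂κ| ≤ ∫ ω, |f ω| ∂κ := abs_integral_le_integral_abs
    _ ≤ ∫ ω, ε + {ω | ε ≤ |f ω|}.indicator (fun _ => (1 : ℝ)) ω ∂κ := by
        refine integral_mono_of_nonneg (Eventually.of_forall fun _ => abs_nonneg _)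
          ((integrable_const ε).add hint) (Eventually.of_forall fun ω => ?_)
        dsimp only
        by_cases h : ω ∈ {ω | ε ≤ |f ω|}
        · rw [Set.indicator_of_mem h]
          linarith [hf1 ω]
        · rw [Set.indicator_of_notMem h, add_zero]
          exact (not_le.1 h).le
    _ = ε + κ.real {ω | ε ≤ |f ω|} := by
        rw [integral_add (integrable_const ε) hint, integral_indicator_const _ hA]
        simp

/-- If bounded random variables tend to zero with summable error probabilities, then so do almost
surely their conditional expectations with respect to arbitrary countably valued observations. -/
lemma ae_tendsto_integral_cond_fiber {Y : ℕ → Ω → β}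
    (hY : ∀ n b, MeasurableSet {ω | Y n ω = b}) {f : ℕ → Ω → ℝ} (hf : ∀ n, Measurable (f n))
    (hf1 : ∀ n ω, |f n ω| ≤ 1)
    (hsum : ∀ ε : ℝ, 0 < ε → ∑' n, μ {ω | ε ≤ |f n ω|} ≠ ∞) :
    ∀ᵐ ω ∂μ, Tendsto (fun n => ∫ ω', f n ω' ∂(μ[|{ω' | Y n ω' = Y n ω}])) atTop (𝓝 0) := by
  have hlim : ∀ k : ℕ, ∀ᵐ ω ∂μ, Tendsto (fun n => (μ[|{ω' | Y n ω' = Y n ω}]).real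
      {ω' | 1 / ((k : ℝ) + 1) ≤ |f n ω'|}) atTop (𝓝 0) := by
    intro k
    have hmeas : ∀ n, Measurable fun ω => (μ[|{ω' | Y n ω' = Y n ω}])
        {ω' | 1 / ((k : ℝ) + 1) ≤ |f n ω'|} := fun n =>
      measurable_comp_of_forall_eq (hY n) fun b => (μ[|{ω' | Y n ω' = b}])
        {ω' | 1 / ((k : ℝ) + 1) ≤ |f n ω'|}
    -- A Borel–Cantelli argument for conditional probabilities: their sum has finite mean, so it
    -- converges almost surely and its terms vanish. Unlike martingale convergence, this needs no
    -- filtration; an unparsed stream need not determine its earlier stages.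
    have hfin : ∫⁻ ω, ∑' n, (μ[|{ω' | Y n ω' = Y n ω}])
        {ω' | 1 / ((k : ℝ) + 1) ≤ |f n ω'|} ∂μ ≠ ∞ := by
      rw [lintegral_tsum fun n => (hmeas n).aemeasurable]
      exact ne_top_of_le_ne_top (hsum _ (by positivity))
        (ENNReal.tsum_le_tsum fun n => (lintegral_cond_fiber (hY n) _).le)
    filter_upwards [ae_lt_top (Measurable.tsum hmeas) hfin] with ω hω
    have := ENNReal.tendsto_atTop_zero_of_tsum_ne_top hω.ne
    exact (ENNReal.tendsto_toReal ENNReal.zero_ne_top).comp this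
  have hpos : ∀ᵐ ω ∂μ, ∀ n, μ {ω' | Y n ω' = Y n ω} ≠ 0 :=
    ae_all_iff.2 fun n => ae_measure_fiber_ne_zero μ (Y n)
  filter_upwards [ae_all_iff.2 hlim, hpos] with ω hω hω0
  rw [Metric.tendsto_atTop]
  intro ε hε
  obtain ⟨k, hk⟩ := exists_nat_one_div_lt (half_pos hε)
  obtain ⟨N, hN⟩ := Metric.tendsto_atTop.1 (hω k) (ε / 2) (half_pos hε)
  refine ⟨N, fun n hn => ?_⟩
  have := cond_isProbabilityMeasure (hω0 n)
  have h1 := abs_integral_le_add_measure (μ[|{ω' | Y n ω' = Y n ω}]) (hf n) (hf1 n)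
    (ε := 1 / ((k : ℝ) + 1)) (by positivity)
  have h2 := hN n hn
  rw [Real.dist_eq, sub_zero] at h2 ⊢
  linarith [le_abs_self ((μ[|{ω' | Y n ω' = Y n ω}]).real {ω' | 1 / ((k : ℝ) + 1) ≤ |f n ω'|})]

end ConditionalConvergence

/-! ### Hoeffding's bound for symbol frequencies -/

section Frequencies

variable {𝒳 : Type*}

open Classical in
/-- The centred indicator of the symbol `x`. -/
noncomputable def centred (P : PMF 𝒳) (x y : 𝒳) : ℝ := (if y = x then 1 else 0) - (P x).toReal

lemma toReal_apply_le_one (P : PMF 𝒳) (x : 𝒳) : (P x).toReal ≤ 1 :=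
  ENNReal.toReal_le_of_le_ofReal zero_le_one (by simpa using P.coe_le_one x)

lemma abs_centred_le_one (P : PMF 𝒳) (x y : 𝒳) : |centred P x y| ≤ 1 := by
  have h0 : 0 ≤ (P x).toReal := ENNReal.toReal_nonneg
  have h1 := toReal_apply_le_one P x
  unfold centred
  split_ifs <;> rw [abs_le] <;> constructor <;> linarith

lemma integral_centred {Ω : Type*} [MeasurableSpace Ω] (κ : Measure Ω) [IsProbabilityMeasure κ]
    (P : PMF 𝒳) (x : 𝒳) {X : Ω → 𝒳} (hX : MeasurableSet {ω | X ω = x}) :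
    ∫ ω, centred P x (X ω) ∂κ = κ.real {ω | X ω = x} - (P x).toReal := by
  have h : (fun ω => centred P x (X ω)) =
      fun ω => {ω | X ω = x}.indicator (fun _ => (1 : ℝ)) ω - (P x).toReal := by
    ext ω
    by_cases h : X ω = x <;> simp [centred, h]
  rw [h, integral_sub ((integrable_const 1).indicator hX) (integrable_const _),
    integral_indicator_const _ hX]
  simp

variable [Fintype 𝒳] [MeasurableSpace 𝒳] [MeasurableSingletonClass 𝒳]

/-- Hoeffding's lemma on `[-1, 1]`; the parameter `1` is the square of half the width. -/
lemma hasSubgaussianMGF_centred (P : PMF 𝒳) (x : 𝒳) (i : ℕ) :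
    HasSubgaussianMGF (fun X : ℕ → 𝒳 => centred P x (X i)) 1
      (Measure.infinitePi fun _ => P.toMeasure) := by
  have hm : Measurable fun X : ℕ → 𝒳 => centred P x (X i) :=
    (Measurable.of_discrete (f := centred P x)).comp (measurable_pi_apply i)
  have h := hasSubgaussianMGF_of_mem_Icc_of_integral_eq_zero (a := -1) (b := 1)
    (μ := Measure.infinitePi fun _ => P.toMeasure) hm.aemeasurable
    (Eventually.of_forall fun X => abs_le.1 (abs_centred_le_one P x (X i))) (by
      have := (measurePreserving_eval_infinitePi (fun _ : ℕ => P.toMeasure) i)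
      rw [integral_centred _ _ _ (this.measurable (measurableSet_singleton x)), Measure.real]
      have h2 := this.measure_preimage (measurableSet_singleton x).nullMeasurableSet
      rw [PMF.toMeasure_apply_singleton _ _ (measurableSet_singleton x)] at h2
      rw [← h2]
      exact sub_self _)
  convert h
  ext
  norm_num

/-- Hoeffding's bound for the frequency of `x` among `N` symbols. -/
lemma measureReal_le_abs_sum_centred (P : PMF 𝒳) (x : 𝒳) (s N : ℕ) {ε : ℝ} (hε : 0 ≤ ε) :
    (Measure.infinitePi fun _ : ℕ => P.toMeasure).real
      {X | ε * N ≤ |∑ i ∈ Finset.range N, centred P x (X (s + i))|} ≤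
      2 * Real.exp (-ε ^ 2 / 2) ^ N := by
  have hind : iIndepFun (fun i (X : ℕ → 𝒳) => centred P x (X (s + i)))
      (Measure.infinitePi fun _ : ℕ => P.toMeasure) :=
    (iIndepFun_infinitePi (P := fun _ : ℕ => P.toMeasure) (X := fun _ => centred P x)
      fun _ => Measurable.of_discrete).precomp (add_right_injective s)
  have hindn : iIndepFun (fun i (X : ℕ → 𝒳) => -centred P x (X (s + i)))
      (Measure.infinitePi fun _ : ℕ => P.toMeasure) :=
    (iIndepFun_infinitePi (P := fun _ : ℕ => P.toMeasure) (X := fun _ y => -centred P x y)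
      fun _ => Measurable.of_discrete).precomp (add_right_injective s)
  have hεN : 0 ≤ ε * N := by positivity
  have h1 := HasSubgaussianMGF.measure_sum_range_ge_le_of_iIndepFun hind (n := N)
    (fun i _ => hasSubgaussianMGF_centred P x (s + i)) hεN
  have h2 := HasSubgaussianMGF.measure_sum_range_ge_le_of_iIndepFun hindn (n := N)
    (fun i _ => (hasSubgaussianMGF_centred P x (s + i)).neg) hεN
  have hexp : Real.exp (-(ε * N) ^ 2 / (2 * N * (1 : NNReal))) = Real.exp (-ε ^ 2 / 2) ^ N := by
    rw [← Real.exp_nat_mul]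
    congr 1
    rcases Nat.eq_zero_or_pos N with rfl | hN
    · simp
    · have : (N : ℝ) ≠ 0 := by positivity
      push_cast
      field_simp
  rw [hexp] at h1 h2
  refine (measureReal_mono (s₂ := {X | ε * N ≤ ∑ i ∈ Finset.range N, centred P x (X (s + i))} ∪
    {X | ε * N ≤ ∑ i ∈ Finset.range N, -centred P x (X (s + i))}) ?_).trans
    ((measureReal_union_le _ _).trans (by linarith))
  intro X hX
  rcases le_abs.1 (show ε * N ≤ |_| from hX) with h | h
  · exact Or.inl h
  · refine Or.inr ?_
    rw [Set.mem_ofPred_eq, Finset.sum_neg_distrib]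
    exact h

end Frequencies

/-! ### Asymptotic secrecy and the rates of the pad -/

section Secrecy

variable {𝒳 : Type*} [Fintype 𝒳] [MeasurableSpace 𝒳] [MeasurableSingletonClass 𝒳]

/-- The stream of `padEncoder c` together with the keys of finitely many earlier stages gives
asymptotically no information on `X_t`. -/
lemma tendsto_cond_view (P : PMF 𝒳) (ν : Measure Unit) [IsProbabilityMeasure ν]
    (c : 𝒳 → Bits) {s t : ℕ} (hst : s ≤ t) (x : 𝒳) :
    ∀ᵐ ω ∂law P ν, Tendsto (fun n => ((law P ν)[|{ω' | (padEncoder c).view n s ω' =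
      (padEncoder c).view n s ω}]).real {ω' | sym t ω' = x}) atTop (𝓝 (P x).toReal) := by
  -- Shifting by `s` leaves exactly the `N` exchangeable stages `s, …, s + N - 1`, over which `f N`
  -- averages.
  let Y : ℕ → Outcome 𝒳 Unit → Bits × List Bits := fun N => (padEncoder c).view (N + s) s
  have hY : ∀ N b, MeasurableSet {ω | Y N ω = b} := fun N b =>
    (padEncoder c).measurableSet_view_eq (N + s) s b
  let f : ℕ → Outcome 𝒳 Unit → ℝ := fun N ω =>
    (∑ i ∈ Finset.range N, centred P x (sym (s + i) ω)) / N
  have hcm : ∀ i, Measurable fun ω : Outcome 𝒳 Unit => centred P x (sym i ω) := fun i =>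
    (Measurable.of_discrete (f := centred P x)).comp
      ((measurable_pi_apply i).comp measurable_fst)
  have hf : ∀ N, Measurable (f N) := fun N =>
    (Finset.measurable_fun_sum _ fun i _ => hcm (s + i)).div_const _
  have hf1 : ∀ N ω, |f N ω| ≤ 1 := by
    intro N ω
    simp only [f, abs_div, Nat.abs_cast]
    refine div_le_one_of_le₀ ((Finset.abs_sum_le_sum_abs _ _).trans ?_) (by positivity)
    exact (Finset.sum_le_sum fun i _ => abs_centred_le_one P x _).trans (by simp)
  have hsum : ∀ ε : ℝ, 0 < ε → ∑' N, law P ν {ω | ε ≤ |f N ω|} ≠ ∞ := by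
    intro ε hε
    have hr : Real.exp (-ε ^ 2 / 2) < 1 := by
      rw [Real.exp_lt_one_iff]
      have : 0 < ε ^ 2 := by positivity
      linarith
    have hs : Summable fun N : ℕ => 2 * Real.exp (-ε ^ 2 / 2) ^ N :=
      (summable_geometric_of_lt_one (Real.exp_pos _).le hr).mul_left 2
    refine ne_top_of_le_ne_top hs.tsum_ofReal_ne_top (ENNReal.tsum_le_tsum fun N => ?_)
    have hmp : MeasurePreserving Prod.fst (law P ν) (Measure.infinitePi fun _ => P.toMeasure) :=
      measurePreserving_fst
    refine (measure_mono fun ω hω => ?_).trans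
      ((hmp.measure_preimage (s := {X | ε * N ≤ |∑ i ∈ Finset.range N, centred P x (X (s + i))|})
        ?_).trans_le ?_)
    · have h : ε ≤ |f N ω| := hω
      rcases Nat.eq_zero_or_pos N with rfl | hN
      · simp
      · simp only [f, abs_div, Nat.abs_cast] at h
        rw [le_div_iff₀ (by positivity)] at h
        exact h
    · refine (measurableSet_le measurable_const (Measurable.abs ?_)).nullMeasurableSet
      exact Finset.measurable_fun_sum _ fun i _ =>
        (Measurable.of_discrete (f := centred P x)).comp (measurable_pi_apply _)
    · rw [← ofReal_measureReal]
      exact ENNReal.ofReal_le_ofReal (measureReal_le_abs_sum_centred P x s N hε.le)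
  filter_upwards [ae_tendsto_integral_cond_fiber hY hf hf1 hsum,
    ae_all_iff.2 fun N => ae_measure_fiber_ne_zero (law P ν) (Y N)] with ω hω hω0
  rw [← tendsto_add_atTop_iff_nat s]
  have := hω.add_const (P x).toReal
  rw [zero_add] at this
  refine this.congr' ?_
  filter_upwards [eventually_gt_atTop t] with N hN
  have := cond_isProbabilityMeasure (hω0 N)
  have hN0 : (N : ℝ) ≠ 0 := by
    have : N ≠ 0 := by omega
    exact_mod_cast this
  simp only [f]
  rw [integral_div, integral_finsetSum]
  -- By exchangeability every summand has the conditional mean of the summand of stage `t`, so the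
  -- average is the posterior of `X_t` minus `P x`.
  · rw [Finset.sum_congr rfl (g := fun _ => ((law P ν)[|{ω' | Y N ω' = Y N ω}]).real
      {ω' | sym t ω' = x} - (P x).toReal)]
    · rw [Finset.sum_const, Finset.card_range, nsmul_eq_mul, mul_div_cancel_left₀ _ hN0]
      exact sub_add_cancel _ _
    · intro i hi
      have hi := Finset.mem_range.1 hi
      rw [integral_centred _ _ _ (measurableSet_sym_eq (s + i) x)]
      congr 1
      exact cond_view_sym_eq P ν c ⟨by omega, by omega⟩ ⟨hst, by omega⟩ (Y N ω) x
  · intro i _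
    exact Integrable.of_bound (hcm _).aestronglyMeasurable 1
      (Eventually.of_forall fun ω => abs_centred_le_one P x _)

lemma lintegral_length_code (P : PMF 𝒳) {V : Type*} [MeasurableSpace V] (ν : Measure V)
    [IsProbabilityMeasure ν] (c : 𝒳 → Bits) (t : ℕ) :
    ∫⁻ ω, ((c (ω.1 t)).length : ℝ≥0∞) ∂law P ν =
      ENNReal.ofReal (∑ x, (P x).toReal * ((c x).length : ℝ)) := by
  have hmp : MeasurePreserving (fun ω : Outcome 𝒳 V => ω.1 t) (law P ν) P.toMeasure :=
    (measurePreserving_eval_infinitePi (fun _ : ℕ => P.toMeasure) t).comp measurePreserving_fst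
  rw [hmp.lintegral_comp (f := fun x => ((c x).length : ℝ≥0∞)) Measurable.of_discrete,
    lintegral_fintype, ENNReal.ofReal_sum_of_nonneg fun _ _ => by positivity]
  refine Finset.sum_congr rfl fun x _ => ?_
  rw [PMF.toMeasure_apply_singleton _ _ (measurableSet_singleton x),
    ENNReal.ofReal_mul ENNReal.toReal_nonneg, ENNReal.ofReal_toReal (P.apply_ne_top x),
    ENNReal.ofReal_natCast, mul_comm]

lemma limsup_average_const (L : ℝ≥0∞) :
    limsup (fun n : ℕ => (∑ _t ∈ Finset.range n, L) / (n : ℝ≥0∞)) atTop = L := by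
  refine Tendsto.limsup_eq (tendsto_const_nhds.congr' ?_)
  filter_upwards [eventually_gt_atTop 0] with n hn
  rw [Finset.sum_const, Finset.card_range, nsmul_eq_mul, mul_comm, mul_div_assoc,
    ENNReal.div_self (by simpa using hn.ne') (by simp), mul_one]

end Secrecy

end RealTimeSecrecy

/-! ### The rate region -/

theorem theorem2 {𝒳 : Type*} [Fintype 𝒳] [Nontrivial 𝒳] [MeasurableSpace 𝒳]
    [MeasurableSingletonClass 𝒳] (P : PMF 𝒳) (hP : ∀ x, P x ≠ 0) (R RK : ℝ≥0∞) :
    (∃ (V : Type) (_ : MeasurableSpace V) (ν : Measure V) (_ : IsProbabilityMeasure ν)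
        (E : Encoder 𝒳 V) (D : Decoder 𝒳),
      Lossless E (law P ν) D ∧ MarkovKeys E (law P ν) ∧ Secret E (law P ν) P ∧
        E.rate (law P ν) ≤ R ∧ E.keyRate (law P ν) ≤ RK) ↔
      ENNReal.ofReal (huffmanLength P) ≤ R ∧ ENNReal.ofReal (huffmanLength P) ≤ RK := by
  constructor
  · rintro ⟨V, _, ν, _, E, D, hD, hM, hS, hR, hRK⟩
    refine ⟨le_trans ?_ hR, le_trans ?_ hRK⟩
    · rw [E.rate_eq]
      exact le_limsup_average fun t => huffmanLength_le_lintegral_word hP hD t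
    · exact le_limsup_average fun t => huffmanLength_le_lintegral_key hP hD hM hS t
  · rintro ⟨hR, hRK⟩
    obtain ⟨l, -, hkraft, hl⟩ := exists_huffmanLength_eq P hP
    obtain ⟨c, hlen, hc⟩ := exists_prefixFree hkraft
    have hL : ∀ t, ∫⁻ ω, ((c (ω.1 t)).length : ℝ≥0∞) ∂law P (Measure.dirac ()) =
        ENNReal.ofReal (huffmanLength P) := by
      intro t
      rw [lintegral_length_code, hl]
      simp_rw [hlen]
    refine ⟨Unit, inferInstance, Measure.dirac (), inferInstance, padEncoder c, padDecoder c hc,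
      lossless_pad hc _, fun t x => ?_, fun t x => ?_, ?_, ?_⟩
    -- Both posteriors tend to `P x`, with the past keys revealed (`s = t`) and without them (`s =
    -- 0`); hence their difference vanishes.
    · filter_upwards [tendsto_cond_view P (Measure.dirac ()) c le_rfl x,
        tendsto_cond_view P (Measure.dirac ()) c (Nat.zero_le t) x] with ω h1 h2
      simp_rw [Encoder.posteriorKey_eq, Encoder.posterior_eq]
      simpa using h1.sub h2
    · simp_rw [Encoder.posterior_eq]
      exact tendsto_cond_view P (Measure.dirac ()) c (Nat.zero_le t) x
    · rw [Encoder.rate_eq]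
      simp_rw [length_padEncoder_word, hL]
      rwa [limsup_average_const]
    · unfold Encoder.keyRate
      simp_rw [length_padEncoder_key, hL]
      rwa [limsup_average_const]
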